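/- A polynomial $p\in\mathbb{R}[z_1,\dots,z_n]$ is *real stable* if $p(z)\neq 0$ whenever $\operatorname{Im} z_i>0$ for all $i$, and *multiaffine* if it has degree at most $1$ in each variable. A point $\mathbf{a}\in\mathbb{R}^n$ is *above the roots* of $p$ if $p(\mathbf{a}+\mathbf{t})\neq 0$ for every $\mathbf{t}\in\mathbb{R}^n$ with all $t_i\ge 0$. Let $k\ge 1$. For a polynomial $p=\sum_{\kappa}a_\kappa z^\kappa$ of degree at most $k$ in each variable, its polarization is the polynomial in the variables $z_{i,j}$ ($1\le i\le n$, $1\le j\le k$) $$\operatorname{Pol}(p)=\sum_{\kappa}a_\kappa\prod_{i=1}^n\frac{e_{\kappa_i}(z_{i,1},\dots,z_{i,k})}{\binom{k}{\kappa_i}},$$ where $e_d$ is the elementary symmetric polynomial of degree $d$. For a multiaffine $q\in\mathbb{R}[z_1,\dots,z_n]$ let $$\tilde q(z_{1,1},\dots,z_{n,k})=q\Big(\sum_{j=1}^k z_{1,j},\dots,\sum_{j=1}^k z_{n,j}\Big),$$ which is again multiaffine, and let $\overline{\tilde q}$ be its flip, where the flip of a multiaffine polynomial $\sum_{S\subseteq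 E}a_S z^S$ in variables indexed by a finite set $E$ is $\sum_{S\subseteq E} a_S z^{E\setminus S}$. For $\mathbf{a}\in\mathbb{R}^n$ let $\overline{\mathbf{a}}\in\mathbb{R}^{nk}$ be the point with $\overline a_{i,j}=a_i$ for all $i,j$. **Theorem.** Let $p,q\in\mathbb{R}[z_1,\dots,z_n]$ be real stable, let $p$ have degree at most $k$ in each variable, where $k\ge1$, and let $q$ be multiaffine. Assume that $q(\partial)p:=q(\partial_1,\dots,\partial_n)p$ is not the zero polynomial. Let $\mathbf{a}\in\mathbb{R}^n$ be above the roots of $p$ and let $\mathbf{b}\in\mathbb{R}^n$ be such that $\overline{\mathbf{b}}$ is above the roots of $\overline{\tilde q}$. Put $$\varphi_i=\frac{\partial_{i,1}\operatorname{Pol}(p)}{\operatorname{Pol}(p)}(\overline{\mathbf{a}})+\frac{\partial_{i,1}\overline{\tilde q}}{\overline{\tilde q}}(\overline{\mathbf{b}}),\qquad 1\le i\le n.$$ Then $\varphi_i>0$ for every $i$, and the point $$\mathbf{c}=\mathbf{a}+\mathbf{b}-\Big(\frac1{\varphi_1},\dots,\frac1{\varphi_n}\Big)$$ is above the roots of $q(\partial)p$.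 -/

import Mathlib

namespace ALS

open MvPolynomial

/-- A real polynomial is real stable if it does not vanish when every variable lies in the open
upper half plane. -/
def RealStable {σ : Type*} (p : MvPolynomial σ ℝ) : Prop :=
  ∀ z : σ → ℂ, (∀ i, 0 < (z i).im) → aeval z p ≠ 0

/-- Degree at most one in each variable. -/
def Multiaffine {σ : Type*} (p : MvPolynomial σ ℝ) : Prop :=
  ∀ i, p.degreeOf i ≤ 1

/-- The point `a` is above the roots of `p`: `p (a + t) ≠ 0` for every `t` in the closed
nonnegative orthant. -/
def AboveRoots {σ : Type*} (a : σ → ℝ) (p : MvPolynomial σ ℝ) : Prop :=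
  ∀ t : σ → ℝ, (∀ i, 0 ≤ t i) → eval (a + t) p ≠ 0

/-- The logarithmic potential `(∂ᵢ p / p)(a)`. -/
noncomputable def potential {σ : Type*} (i : σ) (p : MvPolynomial σ ℝ) (a : σ → ℝ) : ℝ :=
  eval a (pderiv i p) / eval a p

/-- The partial derivative `∂ᵢ` as a linear endomorphism of the polynomial ring. -/
noncomputable def partialD {σ : Type*} (i : σ) : Module.End ℝ (MvPolynomial σ ℝ) :=
  (pderiv i).toLinearMap

theorem partialD_commute {σ : Type*} (i j : σ) :
    Commute (partialD i) (partialD j) := by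
  refine LinearMap.ext fun p => ?_
  have h : ⁅(pderiv i : Derivation ℝ (MvPolynomial σ ℝ) (MvPolynomial σ ℝ)),
      (pderiv j : Derivation ℝ (MvPolynomial σ ℝ) (MvPolynomial σ ℝ))⁆ = 0 := by
    refine MvPolynomial.derivation_ext fun l => ?_
    classical
    rw [Derivation.commutator_apply, pderiv_X, pderiv_X, Derivation.zero_apply,
      Pi.single_apply, Pi.single_apply]
    split_ifs <;> simp
  have := DFunLike.congr_fun h p
  rw [Derivation.commutator_apply, Derivation.zero_apply, sub_eq_zero] at this
  exact this

/-- The differential monomial `∂^m = ∏ᵢ ∂ᵢ ^ (m i)`; the factors commute. -/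
noncomputable def monomialD {σ : Type*} [Fintype σ] (m : σ →₀ ℕ) :
    Module.End ℝ (MvPolynomial σ ℝ) :=
  Finset.univ.noncommProd (fun i => partialD i ^ m i)
    (fun i _ j _ _ => (partialD_commute i j).pow_pow (m i) (m j))

/-- The polynomial `q(∂) p`. -/
noncomputable def diffOp {σ : Type*} [Fintype σ] (q p : MvPolynomial σ ℝ) :
    MvPolynomial σ ℝ :=
  ∑ m ∈ q.support, coeff m q • monomialD m p

/-- The flip of a multiaffine polynomial: `∑_S a_S z^S` becomes `∑_S a_S z^(Sᶜ)`. The exponent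
vectors of a multiaffine polynomial take values in `{0, 1}`, and `m` is sent to `1 - m`. -/
noncomputable def flip {σ : Type*} [Fintype σ] (q : MvPolynomial σ ℝ) : MvPolynomial σ ℝ :=
  ∑ m ∈ q.support, monomial (Finsupp.equivFunOnFinite.symm fun i => 1 - m i) (coeff m q)

/-- The polarization of a polynomial of degree at most `k` in each variable: `zᵢ ^ d` is replaced
by `e_d(z_{i,1}, …, z_{i,k}) / (k choose d)`. -/
noncomputable def polarization {σ : Type*} [Fintype σ] (k : ℕ) (p : MvPolynomial σ ℝ) :
    MvPolynomial (σ × Fin k) ℝ :=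
  ∑ m ∈ p.support, C (coeff m p) *
    ∏ i, (C ((k.choose (m i) : ℝ)⁻¹) * rename (fun j => (i, j)) (esymm (Fin k) ℝ (m i)))

/-- `q̃`, the polynomial `q` with each `zᵢ` replaced by `z_{i,1} + ⋯ + z_{i,k}`. -/
noncomputable def tilde {σ : Type*} (k : ℕ) (q : MvPolynomial σ ℝ) :
    MvPolynomial (σ × Fin k) ℝ :=
  aeval (fun i => ∑ j : Fin k, (X (i, j) : MvPolynomial (σ × Fin k) ℝ)) q

/-- The point in which each coordinate of `a` is repeated `k` times. -/
def repeated {σ : Type*} (k : ℕ) (a : σ → ℝ) : σ × Fin k → ℝ :=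
  fun ij => a ij.1

end ALS

/-! The operator q(∂) is turned into a product of first order operators acting on a multiaffine
polynomial, and a barrier argument is run through the factors. Let f = Pol(p), let g be the flip of
q̃, and put P(x, y) = f(x) g(y) in two copies of the nk variables. A check on monomials shows that
∏_e (∂_{x_e} + ∂_{y_e}) P, evaluated at (x, y), is (q̃(∂) f)(x + y) (`eval_iterSumDeriv_flip`). On
the diagonal f becomes p, and the chain rule turns q̃(∂) into q(∂) (`rename_fst_diffOp_tilde`), so
the value there is that of q(∂)p.

P is multiaffine and real stable, and the repeated point (a, b) is above its roots. For the factor f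
this is the Grace–Walsh–Szegő theorem (`polarEval_ne_zero`), applied to one block of variables at a
time.

The barrier step concerns one factor T = ∂ₓ + ∂ᵧ. With b and c the potentials in directions x and y,
and δ(b + c) ≤ 1, the point lowered by δ in direction x is above the roots of TP
(`AboveRoots.pderiv_add_pderiv`), and no potential has grown (`potential_pderiv_add_pderiv_le`). The
first claim follows from the Rayleigh inequality P · ∂ₓ∂ᵧP ≤ ∂ₓP · ∂ᵧP. For the second, the Rayleigh
difference along a ray in direction w is a nonnegative quadratic, so its discriminant is
nonpositive; this is the bound that `barrier_inequality` needs.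

Since potentials never grow, δ_e = 1/φ_e, computed at the start, is admissible at every stage
(`iterSumDeriv_barrier`). By symmetry φ_e depends only on the block of e, so the final point is
again a repeated one, and its two halves add up to c. -/

namespace ALS

open MvPolynomial

/-! ### Univariate polynomials: Laguerre, Grace–Walsh–Szegő and limits of zero-free polynomials -/

section Univariate

/-- The inversion of a half plane is a disc, hence closed under averaging. -/
theorem mul_normSq_multiset_sum_le (ω : ℂ) (κ : ℝ) (hκ : 0 ≤ κ) (s : Multiset ℂ)
    (hs : ∀ ζ ∈ s, κ * Complex.normSq ζ ≤ (ω * starRingEnd ℂ ζ).re) :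
    κ * Complex.normSq s.sum ≤ s.card * (ω * starRingEnd ℂ s.sum).re := by
  induction s using Multiset.induction_on with
  | empty => simp
  | cons a s ih =>
    have h1 := ih fun ζ hζ => hs ζ (Multiset.mem_cons_of_mem hζ)
    have h2 := hs a (Multiset.mem_cons_self a s)
    rcases s.empty_or_exists_mem with rfl | ⟨b, hb⟩
    · simpa using h2
    have hn : (0 : ℝ) < s.card := by
      exact_mod_cast Multiset.card_pos_iff_exists_mem.mpr ⟨b, hb⟩
    rw [Multiset.sum_cons, Multiset.card_cons]
    generalize s.sum = S at *
    push_cast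
    generalize (s.card : ℝ) = n at *
    simp only [Complex.normSq_apply, Complex.mul_re, Complex.conj_re, Complex.conj_im,
      Complex.add_re, Complex.add_im] at *
    set X := ω.re * S.re - ω.im * -S.im
    set Y := ω.re * a.re - ω.im * -a.im
    have hXY : ω.re * (a.re + S.re) - ω.im * -(a.im + S.im) = X + Y := by
      simp only [X, Y]; ring
    rw [hXY]
    -- The cross term is controlled by expanding κ|n a - S|² ≥ 0; dividing by n is why the empty
    -- multiset was split off.
    have h3 : 2 * κ * (a.re * S.re + a.im * S.im) ≤ X + n * Y := by
      refine le_of_mul_le_mul_left ?_ hn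
      nlinarith [mul_nonneg hκ (sq_nonneg (n * a.re - S.re)),
        mul_nonneg hκ (sq_nonneg (n * a.im - S.im)), mul_le_mul_of_nonneg_left h2 (sq_nonneg n)]
    nlinarith

/-- Laguerre's theorem on polar derivatives with respect to a half plane. -/
theorem polarDerivative_eval_ne_zero (ω : ℂ) (c : ℝ) (K : ℕ) (hK : 0 < K) (f : Polynomial ℂ)
    (hf : f.natDegree ≤ K) (hroots : ∀ r, f.eval r = 0 → (ω * r).re ≤ c) {z w : ℂ}
    (hz : c < (ω * z).re) (hw : c < (ω * w).re) :
    f.eval w + (z - w) * (f.derivative.eval w / K) ≠ 0 := by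
  intro h0
  have hfw : f.eval w ≠ 0 := fun h => absurd (hroots w h) (not_le.mpr hw)
  have hf0 : f ≠ 0 := by rintro rfl; simp at hfw
  have hsp : f.Splits := IsAlgClosed.splits f
  rw [hsp.eval_derivative_eq_eval_mul_sum hfw] at h0
  set κ := (ω * w).re - c with hκ
  set s := f.roots.map fun r => 1 / (w - r) with hs
  have hcard : s.card ≤ K := by
    rw [hs, Multiset.card_map]; exact (Polynomial.card_roots' f).trans hf
  -- Inversion about w sends the half plane containing the roots into a disc through 0. If the polar
  -- derivative vanished, then z = w - K/S with S = f'(w)/f(w), and averaging in the disc would put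
  -- z in the half plane of the roots.
  have key := mul_normSq_multiset_sum_le ω κ (by linarith) s (by
    intro ζ hζ
    obtain ⟨r, hr, rfl⟩ := Multiset.mem_map.mp hζ
    have hr' := hroots r ((Polynomial.mem_roots hf0).mp hr)
    have hne : w - r ≠ 0 := by
      intro h; rw [sub_eq_zero.mp h] at hw; linarith
    have hpos : 0 < Complex.normSq (w - r) := Complex.normSq_pos.mpr hne
    have h1 : ω * starRingEnd ℂ (1 / (w - r)) =
        (Complex.normSq (w - r) : ℂ)⁻¹ * (ω * (w - r)) := by
      rw [one_div, Complex.inv_def]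
      simp only [map_mul, Complex.conj_conj, Complex.conj_ofReal]
      push_cast; ring
    rw [h1, ← Complex.ofReal_inv, Complex.re_ofReal_mul, one_div, Complex.normSq_inv, mul_comm]
    refine mul_le_mul_of_nonneg_left ?_ (inv_nonneg.mpr hpos.le)
    rw [mul_sub, Complex.sub_re]; linarith)
  set S := s.sum
  have hKc : (K : ℂ) ≠ 0 := by exact_mod_cast hK.ne'
  have hKr : (0 : ℝ) < K := by exact_mod_cast hK
  have h1 : (w - z) * S = K := by
    have : f.eval w * ((K : ℂ) - (w - z) * S) = 0 := by
      have h2 : f.eval w + (z - w) * (f.eval w * S / K) =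
        (f.eval w * ((K : ℂ) - (w - z) * S)) / K := by field_simp; ring
      rw [h2] at h0
      simpa [hKc] using h0
    rcases mul_eq_zero.mp this with h | h
    · exact absurd h hfw
    · exact (sub_eq_zero.mp h).symm
  have hS0 : S ≠ 0 := by rintro h; rw [h, mul_zero] at h1; exact hKc h1.symm
  have hpos : 0 < Complex.normSq S := Complex.normSq_pos.mpr hS0
  have h2 : K * (ω * starRingEnd ℂ S).re = Complex.normSq S * (ω * (w - z)).re := by
    rw [← Complex.re_ofReal_mul, ← Complex.re_ofReal_mul, Complex.ofReal_natCast, ← h1,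
      ← Complex.mul_conj]
    congr 1; ring
  -- The degree may be smaller than K; this sign allows the number of roots to be replaced by K.
  have h3 : 0 ≤ (ω * starRingEnd ℂ S).re := by
    by_contra hneg
    push Not at hneg
    have h4 : (s.card : ℝ) * (ω * starRingEnd ℂ S).re ≤ 0 :=
      mul_nonpos_of_nonneg_of_nonpos (Nat.cast_nonneg _) hneg.le
    have h5 : 0 < κ := by linarith
    nlinarith [mul_pos h5 hpos]
  have h4 : κ * Complex.normSq S ≤ Complex.normSq S * (ω * (w - z)).re := by
    rw [← h2]
    exact key.trans (mul_le_mul_of_nonneg_right (by exact_mod_cast hcard) h3)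
  rw [mul_comm] at h4
  have h5 := le_of_mul_le_mul_left h4 hpos
  rw [mul_sub, Complex.sub_re] at h5
  linarith

theorem multiset_esymm_cons_succ {R : Type*} [CommSemiring R] (a : R) (s : Multiset R) (d : ℕ) :
    (a ::ₘ s).esymm (d + 1) = s.esymm (d + 1) + a * s.esymm d := by
  simp [Multiset.esymm, Multiset.powersetCard_cons, Multiset.sum_map_mul_left]

theorem multiset_esymm_zero {R : Type*} [CommSemiring R] (s : Multiset R) : s.esymm 0 = 1 := by
  simp [Multiset.esymm]

theorem multiset_esymm_of_card_lt {R : Type*} [CommSemiring R] (s : Multiset R) {d : ℕ}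
    (h : s.card < d) : s.esymm d = 0 := by
  simp [Multiset.esymm, Multiset.powersetCard_eq_empty d h]

/-- The polarization of a univariate polynomial, evaluated at the points of a multiset. -/
noncomputable def polarEval (f : Polynomial ℂ) (s : Multiset ℂ) : ℂ :=
  ∑ d ∈ Finset.range (s.card + 1), f.coeff d * ((s.card.choose d : ℂ)⁻¹ * s.esymm d)

/-- Polarizing one variable replaces `f` by its polar derivative. -/
theorem polarEval_cons (f : Polynomial ℂ) (z : ℂ) (s : Multiset ℂ) :
    polarEval f (z ::ₘ s) =
      polarEval (f + (Polynomial.C z - Polynomial.X) *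
        (Polynomial.C ((s.card + 1 : ℕ) : ℂ)⁻¹ * f.derivative)) s := by
  set K := s.card with hK
  have hco : ∀ d, (f + (Polynomial.C z - Polynomial.X) *
        (Polynomial.C ((K + 1 : ℕ) : ℂ)⁻¹ * f.derivative)).coeff d =
      f.coeff d * ((K + 1 - d) / (K + 1)) + z * ((d + 1) / (K + 1)) * f.coeff (d + 1) := by
    intro d
    have hK1 : (K : ℂ) + 1 ≠ 0 := by exact_mod_cast Nat.succ_ne_zero K
    rw [Polynomial.coeff_add, sub_mul, Polynomial.coeff_sub, Polynomial.coeff_C_mul,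
      Polynomial.coeff_C_mul]
    rcases d with _ | d
    · simp [Polynomial.coeff_derivative]
      field_simp
    · rw [Polynomial.coeff_X_mul, Polynomial.coeff_C_mul]
      simp only [Polynomial.coeff_derivative]
      push_cast
      field_simp
      ring
  unfold polarEval
  rw [Multiset.card_cons, ← hK]
  simp_rw [hco]
  have hch : ∀ d ∈ Finset.range (K + 1),
      ((K + 1 - d : ℂ) / (K + 1)) * (K.choose d : ℂ)⁻¹ = ((K + 1).choose d : ℂ)⁻¹ := by
    intro d hd
    have hd' : d ≤ K := Nat.lt_succ_iff.mp (Finset.mem_range.mp hd)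
    have h1 : ((K + 1).choose d : ℂ) ≠ 0 := by
      exact_mod_cast (Nat.choose_pos (by omega)).ne'
    have h2 : (K.choose d : ℂ) ≠ 0 := by exact_mod_cast (Nat.choose_pos hd').ne'
    have hK1 : (K : ℂ) + 1 ≠ 0 := by exact_mod_cast Nat.succ_ne_zero K
    have h3 := Nat.choose_mul_succ_eq K d
    have h4 : (K.choose d : ℂ) * (K + 1) = (K + 1).choose d * (K + 1 - d) := by
      have : ((K + 1 - d : ℕ) : ℂ) = K + 1 - d := by
        rw [Nat.cast_sub (by omega)]; push_cast; ring
      rw [← this]; exact_mod_cast h3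
    field_simp
    linear_combination -h4
  have hch' : ∀ d ∈ Finset.range (K + 1),
      ((d + 1 : ℂ) / (K + 1)) * (K.choose d : ℂ)⁻¹ = ((K + 1).choose (d + 1) : ℂ)⁻¹ := by
    intro d hd
    have hd' : d ≤ K := Nat.lt_succ_iff.mp (Finset.mem_range.mp hd)
    have h1 : ((K + 1).choose (d + 1) : ℂ) ≠ 0 := by
      exact_mod_cast (Nat.choose_pos (by omega)).ne'
    have h2 : (K.choose d : ℂ) ≠ 0 := by exact_mod_cast (Nat.choose_pos hd').ne'
    have hK1 : (K : ℂ) + 1 ≠ 0 := by exact_mod_cast Nat.succ_ne_zero K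
    have h4 : ((K : ℂ) + 1) * K.choose d = (K + 1).choose (d + 1) * (d + 1) := by
      exact_mod_cast Nat.add_one_mul_choose_eq K d
    field_simp
    linear_combination -h4
  -- The two parts of the d-th coefficient match the two terms of e_{d+1}(z, s) = e_{d+1}(s) + z
  -- e_d(s), after a shift of index in the first.
  have hR : ∀ d ∈ Finset.range (K + 1),
      (f.coeff d * ((K + 1 - d) / (K + 1)) + z * ((d + 1) / (K + 1)) * f.coeff (d + 1)) *
        ((K.choose d : ℂ)⁻¹ * s.esymm d) =
      f.coeff d * (((K + 1).choose d : ℂ)⁻¹ * s.esymm d) +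
        f.coeff (d + 1) * (((K + 1).choose (d + 1) : ℂ)⁻¹ * (z * s.esymm d)) := by
    intro d hd
    rw [← hch d hd, ← hch' d hd]; ring
  rw [Finset.sum_congr rfl hR, Finset.sum_add_distrib, Finset.sum_range_succ']
  have hz : ∑ d ∈ Finset.range (K + 1), f.coeff d * (((K + 1).choose d : ℂ)⁻¹ * s.esymm d) =
      ∑ d ∈ Finset.range (K + 1),
        f.coeff (d + 1) * (((K + 1).choose (d + 1) : ℂ)⁻¹ * s.esymm (d + 1)) +
      f.coeff 0 * (((K + 1).choose 0 : ℂ)⁻¹ * s.esymm 0) := by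
    rw [← Finset.sum_range_succ'
      (fun d => f.coeff d * (((K + 1).choose d : ℂ)⁻¹ * s.esymm d)) (K + 1),
      Finset.sum_range_succ _ (K + 1),
      multiset_esymm_of_card_lt s (d := K + 1) (by omega), mul_zero, mul_zero, add_zero]
  rw [hz, add_right_comm, ← Finset.sum_add_distrib]
  congr 1
  · refine Finset.sum_congr rfl fun d _ => ?_
    rw [multiset_esymm_cons_succ]; ring
  · simp [multiset_esymm_zero]

/-- The Grace–Walsh–Szegő theorem for a half plane. -/
theorem polarEval_ne_zero (ω : ℂ) (c : ℝ) (s : Multiset ℂ) (f : Polynomial ℂ) (hf0 : f ≠ 0)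
    (hf : f.natDegree ≤ s.card) (hroots : ∀ r, f.eval r = 0 → (ω * r).re ≤ c)
    (hs : ∀ z ∈ s, c < (ω * z).re) : polarEval f s ≠ 0 := by
  induction s using Multiset.induction_on generalizing f with
  | empty =>
    have h := Polynomial.eq_C_of_natDegree_le_zero hf
    simp only [polarEval, Multiset.card_zero, zero_add, Finset.range_one, Finset.sum_singleton,
      Nat.choose_self, multiset_esymm_zero]
    intro h'
    rw [h] at hf0
    simp at h' hf0
    exact hf0 h'
  | cons z s ih =>
    rw [polarEval_cons]
    rw [Multiset.card_cons] at hf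
    set g := f + (Polynomial.C z - Polynomial.X) *
        (Polynomial.C ((s.card + 1 : ℕ) : ℂ)⁻¹ * f.derivative) with hg
    have hev : ∀ w, g.eval w =
        f.eval w + (z - w) * (f.derivative.eval w / ((s.card + 1 : ℕ) : ℂ)) := by
      intro w; simp [hg, div_eq_inv_mul]
    have hz := hs z (Multiset.mem_cons_self z s)
    have hne : ∀ w, c < (ω * w).re → g.eval w ≠ 0 := by
      intro w hw
      rw [hev]
      exact polarDerivative_eval_ne_zero ω c _ (Nat.succ_pos _) f hf hroots hz hw
    have hg0 : g ≠ 0 := by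
      intro h
      exact hne z hz (by rw [h]; simp)
    refine ih g hg0 ?_ ?_ fun w hw => hs w (Multiset.mem_cons_of_mem hw)
    -- The polar derivative loses a degree: in degree `s.card + 1` the coefficient of f cancels
    -- against that of X f' / (s.card + 1).
    · refine Polynomial.natDegree_le_iff_coeff_eq_zero.mpr fun N hN => ?_
      have hK1 : (s.card : ℂ) + 1 ≠ 0 := by exact_mod_cast Nat.succ_ne_zero s.card
      obtain ⟨N, rfl⟩ : ∃ M, N = M + 1 := ⟨N - 1, by omega⟩
      have h2 : f.coeff (N + 2) = 0 := Polynomial.coeff_eq_zero_of_natDegree_lt (by omega)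
      rw [hg, Polynomial.coeff_add, sub_mul, Polynomial.coeff_sub, Polynomial.coeff_C_mul,
        Polynomial.coeff_C_mul, Polynomial.coeff_X_mul, Polynomial.coeff_C_mul]
      simp only [Polynomial.coeff_derivative, h2]
      by_cases hN' : N = s.card
      · subst hN'
        push_cast
        field_simp
        ring
      · have h1 : f.coeff (N + 1) = 0 := Polynomial.coeff_eq_zero_of_natDegree_lt (by omega)
        simp [h1]
    · intro r hr
      by_contra h
      exact hne r (not_le.mp h) hr

/-- A polynomial without zeros in the upper half plane is controlled everywhere by its value at
one point of the half plane. -/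
theorem norm_eval_le_of_forall_ne_zero (k : ℕ) (f : Polynomial ℂ) (hf : f.natDegree ≤ k)
    (hne : ∀ z : ℂ, 0 < z.im → f.eval z ≠ 0) (z w : ℂ) (hz : 0 < z.im) :
    ‖f.eval w‖ ≤ ‖f.eval z‖ * (1 + ‖w - z‖ / z.im) ^ k := by
  have hsp : f.Splits := IsAlgClosed.splits f
  have hf0 : f ≠ 0 := by
    rintro rfl; exact hne z hz (by simp)
  have hC : 1 ≤ 1 + ‖w - z‖ / z.im := le_add_of_nonneg_right (by positivity)
  set M := 1 + ‖w - z‖ / z.im with hM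
  have hr : ∀ r ∈ f.roots, ‖w - r‖ ≤ ‖z - r‖ * M := by
    intro r hr
    have h1 : r.im ≤ 0 := by
      by_contra h
      exact hne r (not_le.mp h) ((Polynomial.mem_roots hf0).mp hr)
    -- A root in the closed lower half plane is at distance at least Im z from z, so moving from z
    -- to w multiplies each root distance by at most M.
    have h2 : z.im ≤ ‖z - r‖ := by
      have := (le_abs_self _).trans (Complex.abs_im_le_norm (z - r))
      rw [Complex.sub_im] at this; linarith
    calc ‖w - r‖ = ‖(z - r) + (w - z)‖ := by congr 1; ring
      _ ≤ ‖z - r‖ + ‖w - z‖ := norm_add_le _ _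
      _ ≤ ‖z - r‖ + ‖z - r‖ * (‖w - z‖ / z.im) := by
          gcongr
          rw [mul_div_assoc', le_div_iff₀ hz, mul_comm]
          gcongr
      _ = ‖z - r‖ * M := by rw [hM]; ring
  have hprod : ∀ s : Multiset ℂ, (∀ r ∈ s, ‖w - r‖ ≤ ‖z - r‖ * M) →
      ‖(s.map fun r => w - r).prod‖ ≤ ‖(s.map fun r => z - r).prod‖ * M ^ s.card := by
    intro s
    induction s using Multiset.induction_on with
    | empty => simp
    | cons a s ih =>
      intro h
      have h1 := h a (Multiset.mem_cons_self a s)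
      have h2 := ih fun r hr => h r (Multiset.mem_cons_of_mem hr)
      rw [Multiset.map_cons, Multiset.prod_cons, Multiset.map_cons, Multiset.prod_cons,
        norm_mul, norm_mul, Multiset.card_cons, pow_succ]
      calc _ ≤ (‖z - a‖ * M) * (‖(s.map fun r => z - r).prod‖ * M ^ s.card) := by gcongr
        _ = _ := by ring
  rw [hsp.eval_eq_prod_roots, hsp.eval_eq_prod_roots, norm_mul, norm_mul, mul_assoc]
  gcongr
  refine (hprod _ hr).trans ?_
  gcongr
  exact (Polynomial.card_roots' f).trans hf

/-- A pointwise limit of polynomials of bounded degree without zeros in the upper half plane is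
zero or has no zeros there. -/
theorem eval_ne_zero_of_tendsto (k : ℕ) (F : ℝ → Polynomial ℂ) (f : Polynomial ℂ)
    (hdeg : ∀ ε, (F ε).natDegree ≤ k)
    (hne : ∀ ε, 0 < ε → ∀ z : ℂ, 0 < z.im → (F ε).eval z ≠ 0)
    (hlim : ∀ z, Filter.Tendsto (fun ε => (F ε).eval z) (nhdsWithin 0 (Set.Ioi 0))
      (nhds (f.eval z)))
    (hf : f ≠ 0) (z : ℂ) (hz : 0 < z.im) : f.eval z ≠ 0 := by
  intro h0
  refine hf (Polynomial.funext fun w => ?_)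
  -- The bound has a constant independent of ε and survives the limit; a zero of f at z would then
  -- force f(w) = 0 for every w. This replaces Hurwitz's theorem.
  have h1 : ∀ᶠ ε in nhdsWithin (0 : ℝ) (Set.Ioi 0),
      ‖(F ε).eval w‖ ≤ ‖(F ε).eval z‖ * (1 + ‖w - z‖ / z.im) ^ k := by
    filter_upwards [self_mem_nhdsWithin] with ε hε
    exact norm_eval_le_of_forall_ne_zero k (F ε) (hdeg ε) (hne ε hε) z w hz
  have h2 := le_of_tendsto_of_tendsto (hlim w).norm ((hlim z).norm.mul_const _) h1
  rw [h0, norm_zero, zero_mul] at h2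
  simpa using h2

end Univariate

/-! ### Polarization preserves stability and points above the roots -/

section Polarization

variable {σ : Type*}

/-- The value of `p` when the powers of the `i`-th variable are replaced by the sequence `u i`. -/
noncomputable def umbralEval [Fintype σ] (p : MvPolynomial σ ℝ) (u : σ → ℕ → ℂ) : ℂ :=
  ∑ m ∈ p.support, ((coeff m p : ℝ) : ℂ) * ∏ i, u i (m i)

theorem aeval_eq_umbralEval [Fintype σ] (p : MvPolynomial σ ℝ) (w : σ → ℂ) :
    aeval w p = umbralEval p fun i d => w i ^ d := by
  rw [aeval_def, eval₂_eq']; rfl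

/-- The normalized elementary symmetric functions of the `i`-th block of variables. -/
noncomputable def blockSymm (k : ℕ) (z : σ × Fin k → ℂ) (i : σ) (d : ℕ) : ℂ :=
  (k.choose d : ℂ)⁻¹ * (Finset.univ.val.map fun j => z (i, j)).esymm d

theorem aeval_polarization [Fintype σ] (k : ℕ) (p : MvPolynomial σ ℝ) (z : σ × Fin k → ℂ) :
    aeval z (polarization k p) = umbralEval p (blockSymm k z) := by
  simp only [polarization, umbralEval, map_sum, map_mul, map_prod, aeval_C, aeval_rename,
    aeval_esymm_eq_multiset_esymm, blockSymm]
  refine Finset.sum_congr rfl fun m _ => ?_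
  congr 1
  refine Finset.prod_congr rfl fun i _ => ?_
  simp

/-- The univariate polynomial obtained by evaluating all variables but the `i`-th one. -/
noncomputable def slice [Fintype σ] [DecidableEq σ] (p : MvPolynomial σ ℝ) (u : σ → ℕ → ℂ) (i : σ) : Polynomial ℂ :=
  ∑ m ∈ p.support, Polynomial.C (((coeff m p : ℝ) : ℂ) * ∏ l ∈ Finset.univ.erase i, u l (m l)) *
    Polynomial.X ^ m i

theorem natDegree_slice_le [Fintype σ] [DecidableEq σ] {k : ℕ} {p : MvPolynomial σ ℝ} {i : σ} (hp : p.degreeOf i ≤ k)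
    (u : σ → ℕ → ℂ) : (slice p u i).natDegree ≤ k :=
  Polynomial.natDegree_sum_le_of_forall_le _ _ fun _ hm =>
    (Polynomial.natDegree_C_mul_X_pow_le _ _).trans ((monomial_le_degreeOf i hm).trans hp)

theorem sum_coeff_slice [Fintype σ] [DecidableEq σ] {k : ℕ} {p : MvPolynomial σ ℝ} {i : σ} (hp : p.degreeOf i ≤ k)
    (u : σ → ℕ → ℂ) (v : ℕ → ℂ) :
    ∑ d ∈ Finset.range (k + 1), (slice p u i).coeff d * v d =
      umbralEval p (Function.update u i v) := by
  simp only [slice, Polynomial.finsetSum_coeff, Polynomial.coeff_C_mul, Polynomial.coeff_X_pow,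
    Finset.sum_mul, umbralEval]
  rw [Finset.sum_comm]
  refine Finset.sum_congr rfl fun m hm => ?_
  rw [Finset.sum_eq_single (m i)]
  · rw [← Finset.mul_prod_erase _ _ (Finset.mem_univ i), Function.update_self,
      Finset.prod_congr rfl (f := fun l => Function.update u i v l (m l))
        (g := fun l => u l (m l)) fun l hl => by
          rw [Function.update_of_ne (Finset.ne_of_mem_erase hl)]]
    simp only [if_true]
    ring
  · intro d _ hd
    simp [hd]
  · intro h
    have := (monomial_le_degreeOf i hm).trans hp
    exact absurd (Finset.mem_range.mpr (Nat.lt_succ_of_le this)) h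

theorem eval_slice [Fintype σ] [DecidableEq σ] {k : ℕ} {p : MvPolynomial σ ℝ} {i : σ} (hp : p.degreeOf i ≤ k)
    (u : σ → ℕ → ℂ) (w : ℂ) :
    (slice p u i).eval w = umbralEval p (Function.update u i fun d => w ^ d) := by
  rw [Polynomial.eval_eq_sum_range' (Nat.lt_succ_of_le (natDegree_slice_le hp u)),
    sum_coeff_slice hp]

theorem polarEval_slice [Fintype σ] [DecidableEq σ] {k : ℕ} {p : MvPolynomial σ ℝ} {i : σ} (hp : p.degreeOf i ≤ k)
    (u : σ → ℕ → ℂ) (z : σ × Fin k → ℂ) :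
    polarEval (slice p u i) (Finset.univ.val.map fun j => z (i, j)) =
      umbralEval p (Function.update u i (blockSymm k z i)) := by
  rw [← sum_coeff_slice hp, polarEval, Multiset.card_map, Finset.card_val, Finset.card_univ,
    Fintype.card_fin]
  rfl

/-- The powers of the variables outside `S` and the symmetric functions of the blocks in `S`. -/
noncomputable def mixedSymm [DecidableEq σ] (k : ℕ) (S : Finset σ) (z : σ × Fin k → ℂ) (w : σ → ℂ) (i : σ) :
    ℕ → ℂ :=
  if i ∈ S then blockSymm k z i else fun d => w i ^ d

theorem mixedSymm_empty [DecidableEq σ] (k : ℕ) (z : σ × Fin k → ℂ) (w : σ → ℂ) :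
    mixedSymm k ∅ z w = fun i d => w i ^ d := by
  funext i
  simp [mixedSymm]

theorem update_mixedSymm_insert [DecidableEq σ] (k : ℕ) (S : Finset σ) (i : σ) (z : σ × Fin k → ℂ) (w : σ → ℂ) :
    Function.update (mixedSymm k S z w) i (blockSymm k z i) = mixedSymm k (insert i S) z w := by
  funext l
  by_cases h : l = i
  · subst h; simp [mixedSymm]
  · simp [mixedSymm, h]

theorem update_mixedSymm_pow [DecidableEq σ] (k : ℕ) (S : Finset σ) {i : σ} (hi : i ∉ S) (z : σ × Fin k → ℂ)
    (w : σ → ℂ) (v : ℂ) :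
    Function.update (mixedSymm k S z w) i (fun d => v ^ d) =
      mixedSymm k S z (Function.update w i v) := by
  funext l
  by_cases h : l = i
  · subst h; simp [mixedSymm, hi]
  · simp [mixedSymm, h]

/-- Blocks are polarized one at a time. The slice in the next variable is zero-free in the upper
half plane by induction, and Grace–Walsh–Szegő applies with ω = -i, c = 0, since Re(-iz) = Im z. -/
theorem umbralEval_mixedSymm_ne_zero [Fintype σ] [DecidableEq σ] {k : ℕ} {p : MvPolynomial σ ℝ} (hp : RealStable p)
    (hpk : ∀ i, p.degreeOf i ≤ k) (S : Finset σ) (z : σ × Fin k → ℂ) (hz : ∀ e, 0 < (z e).im)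
    (w : σ → ℂ) (hw : ∀ i, 0 < (w i).im) : umbralEval p (mixedSymm k S z w) ≠ 0 := by
  induction S using Finset.induction_on generalizing w with
  | empty =>
    have := hp w hw
    rwa [mixedSymm_empty, ← aeval_eq_umbralEval]
  | insert i S hi ih =>
    rw [← update_mixedSymm_insert, ← polarEval_slice (hpk i)]
    have hne : ∀ v : ℂ, 0 < v.im → (slice p (mixedSymm k S z w) i).eval v ≠ 0 := by
      intro v hv
      rw [eval_slice (hpk i), update_mixedSymm_pow k S hi]
      refine ih _ fun l => ?_
      by_cases h : l = i
      · subst h; simpa using hv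
      · simpa [h] using hw l
    refine polarEval_ne_zero (-Complex.I) 0 _ _ ?_ ?_ ?_ ?_
    · intro h
      exact hne Complex.I (by simp) (by rw [h]; simp)
    · simpa using natDegree_slice_le (hpk i) _
    · intro r hr
      by_contra h
      exact hne r (by simpa using h) hr
    · intro v hv
      obtain ⟨j, _, rfl⟩ := Multiset.mem_map.mp hv
      simpa using hz (i, j)

theorem RealStable.polarization [Fintype σ] {k : ℕ} {p : MvPolynomial σ ℝ} (hp : RealStable p)
    (hpk : ∀ i, p.degreeOf i ≤ k) : RealStable (polarization k p) := by
  classical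
  intro z hz
  have := umbralEval_mixedSymm_ne_zero hp hpk Finset.univ z hz (fun _ => Complex.I) (by simp)
  rw [aeval_polarization]
  convert this using 2
  funext i
  simp [mixedSymm]

theorem continuous_umbralEval_mixedSymm [Fintype σ] [DecidableEq σ] (k : ℕ) (p : MvPolynomial σ ℝ) (S : Finset σ)
    (z : ℝ → σ × Fin k → ℂ) (w : ℝ → σ → ℂ) (hz : Continuous z) (hw : Continuous w) :
    Continuous fun ε => umbralEval p (mixedSymm k S (z ε) (w ε)) := by
  unfold umbralEval
  refine continuous_finsetSum _ fun m _ => continuous_const.mul ?_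
  refine continuous_finsetProd _ fun i _ => ?_
  by_cases h : i ∈ S
  · simp only [mixedSymm, if_pos h, blockSymm, Finset.esymm_map_val]
    fun_prop
  · simp only [mixedSymm, if_neg h]
    fun_prop

theorem conj_umbralEval [Fintype σ] (p : MvPolynomial σ ℝ) (u : σ → ℕ → ℂ) :
    starRingEnd ℂ (umbralEval p u) = umbralEval p fun i d => starRingEnd ℂ (u i d) := by
  simp [umbralEval, map_sum, map_mul, map_prod]

theorem conj_mixedSymm [DecidableEq σ] (k : ℕ) (S : Finset σ) (z : σ × Fin k → ℂ) (w : σ → ℂ) (i : σ) (d : ℕ) :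
    starRingEnd ℂ (mixedSymm k S z w i d) =
      mixedSymm k S (fun e => starRingEnd ℂ (z e)) (fun l => starRingEnd ℂ (w l)) i d := by
  by_cases h : i ∈ S
  · simp only [mixedSymm, if_pos h, blockSymm, Finset.esymm_map_val, map_sum, map_prod, map_mul,
      map_inv₀, map_natCast]
  · simp [mixedSymm, h]

/-- The slice in the next variable is a limit of slices at points of the upper half plane and
commutes with conjugation, so it is real-rooted. Induction puts its roots strictly below `a i`, and
Grace–Walsh–Szegő applies to a half plane Re z > c with c < `a i`. -/
theorem umbralEval_mixedSymm_ofReal_ne_zero [Fintype σ] [DecidableEq σ] {k : ℕ} {p : MvPolynomial σ ℝ} (hp : RealStable p)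
    (hpk : ∀ i, p.degreeOf i ≤ k) {a : σ → ℝ} (ha : AboveRoots a p) (S : Finset σ)
    (x : σ × Fin k → ℝ) (hx : ∀ e, a e.1 ≤ x e) (w : σ → ℝ) (hw : ∀ i, a i ≤ w i) :
    umbralEval p (mixedSymm k S (fun e => (x e : ℂ)) fun i => (w i : ℂ)) ≠ 0 := by
  induction S using Finset.induction_on generalizing w with
  | empty =>
    have h1 := ha (w - a) fun i => by simpa using hw i
    have h2 : aeval (fun i => (w i : ℂ)) p = ((eval w p : ℝ) : ℂ) := by
      have := aeval_algebraMap_apply ℂ w p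
      simpa [Function.comp_def, coe_aeval_eq_eval] using this
    rw [add_sub_cancel] at h1
    rw [aeval_eq_umbralEval] at h2
    have h3 : umbralEval p (fun i d => (w i : ℂ) ^ d) ≠ 0 := by
      rw [h2]
      exact_mod_cast h1
    rwa [mixedSymm_empty]
  | insert i S hi ih =>
    rw [← update_mixedSymm_insert, ← polarEval_slice (hpk i)]
    set f := slice p (mixedSymm k S (fun e => (x e : ℂ)) fun i => (w i : ℂ)) i with hf
    have hreal : ∀ t : ℝ, a i ≤ t → f.eval (t : ℂ) ≠ 0 := by
      intro t ht
      rw [hf, eval_slice (hpk i), update_mixedSymm_pow k S hi]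
      have h1 := ih (Function.update w i t) fun l => by
        by_cases h : l = i
        · subst h; simpa using ht
        · simpa [h] using hw l
      convert h1 using 3
      funext l
      by_cases h : l = i
      · subst h; simp
      · simp [h]
    have hf0 : f ≠ 0 := fun h => hreal (a i) le_rfl (by rw [h]; simp)
    have hupper : ∀ v : ℂ, 0 < v.im → f.eval v ≠ 0 := by
      refine eval_ne_zero_of_tendsto k
        (fun ε => slice p (mixedSymm k S (fun e => (x e : ℂ) + ε * Complex.I)
          fun i => (w i : ℂ) + ε * Complex.I) i) f
        (fun ε => natDegree_slice_le (hpk i) _) ?_ ?_ hf0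
      · intro ε hε v hv
        rw [eval_slice (hpk i), update_mixedSymm_pow k S hi]
        refine umbralEval_mixedSymm_ne_zero hp hpk S _ (fun e => by simpa using hε) _ fun l => ?_
        by_cases h : l = i
        · subst h; simpa using hv
        · simpa [h] using hε
      · intro v
        simp only [hf, eval_slice (hpk i), update_mixedSymm_pow k S hi]
        have hc := continuous_umbralEval_mixedSymm k p S
          (fun ε e => (x e : ℂ) + ε * Complex.I)
          (fun ε => Function.update (fun i => (w i : ℂ) + ε * Complex.I) i v)
          (by fun_prop) (Continuous.update (by fun_prop) i continuous_const)
        have := (hc.tendsto 0).mono_left (nhdsWithin_le_nhds (s := Set.Ioi 0))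
        simpa using this
    have hconj : ∀ v, starRingEnd ℂ (f.eval v) = f.eval (starRingEnd ℂ v) := by
      intro v
      rw [hf, eval_slice (hpk i), update_mixedSymm_pow k S hi, eval_slice (hpk i),
        update_mixedSymm_pow k S hi, conj_umbralEval]
      congr 1
      funext l d
      rw [conj_mixedSymm]
      congr 1
      · funext e; simp
      · funext l'
        by_cases h : l' = i
        · subst h; simp
        · simp [h]
    have hroot : ∀ r, f.eval r = 0 → r.re < a i := by
      intro r hr
      have him : r.im = 0 := by
        rcases lt_trichotomy r.im 0 with h | h | h
        · refine absurd ?_ (hupper (starRingEnd ℂ r) (by simpa using h))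
          rw [← hconj, hr, map_zero]
        · exact h
        · exact absurd hr (hupper r h)
      by_contra h
      refine hreal r.re (not_lt.mp h) ?_
      rwa [show ((r.re : ℝ) : ℂ) = r from Complex.ext (by simp) (by simp [him])]
    -- The points may equal `a i`, so a boundary strictly below it is needed; `a i - 1` covers the
    -- case without roots.
    obtain ⟨c, hc, hcr⟩ : ∃ c < a i, ∀ r ∈ f.roots.toFinset, r.re ≤ c := by
      have hne : (insert (a i - 1) (f.roots.toFinset.image Complex.re)).Nonempty :=
        Finset.insert_nonempty _ _
      refine ⟨(insert (a i - 1) (f.roots.toFinset.image Complex.re)).max' hne, ?_, ?_⟩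
      · rw [Finset.max'_lt_iff]
        intro y hy
        rcases Finset.mem_insert.mp hy with rfl | hy
        · linarith
        · obtain ⟨r, hr, rfl⟩ := Finset.mem_image.mp hy
          exact hroot r ((Polynomial.mem_roots hf0).mp (Multiset.mem_toFinset.mp hr))
      · intro r hr
        exact Finset.le_max' _ _ (Finset.mem_insert_of_mem (Finset.mem_image_of_mem _ hr))
    refine polarEval_ne_zero 1 c _ _ hf0 ?_ ?_ ?_
    · simpa using natDegree_slice_le (hpk i) _
    · intro r hr
      rw [one_mul]
      exact hcr r (Multiset.mem_toFinset.mpr ((Polynomial.mem_roots hf0).mpr hr))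
    · intro v hv
      obtain ⟨j, _, rfl⟩ := Multiset.mem_map.mp hv
      simpa using lt_of_lt_of_le hc (hx (i, j))

theorem AboveRoots.polarization [Fintype σ] {k : ℕ} {p : MvPolynomial σ ℝ} (hp : RealStable p)
    (hpk : ∀ i, p.degreeOf i ≤ k) {a : σ → ℝ} (ha : AboveRoots a p) :
    AboveRoots (repeated k a) (polarization k p) := by
  classical
  intro t ht h0
  have h1 := umbralEval_mixedSymm_ofReal_ne_zero hp hpk ha Finset.univ (repeated k a + t)
    (fun e => by simpa [repeated] using ht e) a fun _ => le_rfl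
  refine h1 ?_
  have h2 : aeval (fun e => (((repeated k a + t) e : ℝ) : ℂ)) (ALS.polarization k p) =
      ((eval (repeated k a + t) (ALS.polarization k p) : ℝ) : ℂ) := by
    have := aeval_algebraMap_apply ℂ (repeated k a + t) (ALS.polarization k p)
    simpa [Function.comp_def, coe_aeval_eq_eval] using this
  rw [h0, aeval_polarization, Complex.ofReal_zero] at h2
  convert h2 using 2
  funext i
  simp [mixedSymm]

end Polarization

/-! ### Multiaffine polynomials -/

section MultiaffineBasics

variable {σ : Type*}

theorem pderiv_pderiv_comm (i j : σ) (p : MvPolynomial σ ℝ) :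
    pderiv i (pderiv j p) = pderiv j (pderiv i p) :=
  LinearMap.congr_fun (partialD_commute i j) p

theorem degreeOf_pderiv_le (i j : σ) (p : MvPolynomial σ ℝ) :
    (pderiv j p).degreeOf i ≤ p.degreeOf i := by
  refine degreeOf_le_iff.mpr fun m hm => ?_
  rw [mem_support_iff, coeff_pderiv] at hm
  have := monomial_le_degreeOf i (mem_support_iff.mpr (left_ne_zero_of_mul hm))
  rw [Finsupp.add_apply] at this
  omega

theorem Multiaffine.pderiv {p : MvPolynomial σ ℝ} (hp : Multiaffine p) (j : σ) :
    Multiaffine (pderiv j p) :=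
  fun i => (degreeOf_pderiv_le i j p).trans (hp i)

theorem Multiaffine.add {p q : MvPolynomial σ ℝ} (hp : Multiaffine p) (hq : Multiaffine q) :
    Multiaffine (p + q) :=
  fun i => (degreeOf_add_le i p q).trans (max_le (hp i) (hq i))

theorem Multiaffine.pderiv_pderiv_self {p : MvPolynomial σ ℝ} (hp : Multiaffine p) (i : σ) :
    MvPolynomial.pderiv i (MvPolynomial.pderiv i p) = 0 := by
  ext m
  rw [coeff_pderiv, coeff_pderiv, coeff_zero]
  by_cases h : coeff (m + Finsupp.single i 1 + Finsupp.single i 1) p = 0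
  · rw [h]; ring
  · have := (monomial_le_degreeOf i (mem_support_iff.mpr h)).trans (hp i)
    simp at this

variable {A : Type*} [CommRing A] [Algebra ℝ A] [DecidableEq σ]

theorem aeval_monomial_add_single {i : σ} {n : σ →₀ ℕ} (hn : n i = 0) (c : ℝ) (z : σ → A) (t : A) :
    aeval (z + Pi.single i t) (monomial n c) = aeval z (monomial n c) := by
  rw [aeval_monomial, aeval_monomial]
  congr 1
  refine Finsupp.prod_congr fun l hl => ?_
  have : l ≠ i := by
    rintro rfl
    exact Finsupp.mem_support_iff.mp hl hn
  simp [this]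

/-- A multiaffine polynomial is affine along each coordinate direction. -/
theorem aeval_add_single {p : MvPolynomial σ ℝ} (hp : Multiaffine p) (i : σ) (z : σ → A) (t : A) :
    aeval (z + Pi.single i t) p = aeval z p + t * aeval z (pderiv i p) := by
  have hmono : ∀ m ∈ p.support, aeval (z + Pi.single i t) (monomial m (coeff m p)) =
      aeval z (monomial m (coeff m p)) + t * aeval z (pderiv i (monomial m (coeff m p))) := by
    intro m hm
    have h1 := (monomial_le_degreeOf i hm).trans (hp i)
    generalize coeff m p = c
    rw [pderiv_monomial]
    rcases Nat.le_one_iff_eq_zero_or_eq_one.mp h1 with h | h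
    · rw [aeval_monomial_add_single h, h]
      simp
    · have h2 : m = (m - Finsupp.single i 1) + Finsupp.single i 1 := by
        ext l
        by_cases hl : l = i
        · subst hl; simp [h]
        · simp [Ne.symm hl]
      have h3 : (m - Finsupp.single i 1 : σ →₀ ℕ) i = 0 := by simp [h]
      generalize hn : m - Finsupp.single i 1 = n at *
      have h4 : monomial m c = monomial n c * X i := by
        rw [h2, X, monomial_mul, mul_one]
      rw [h4, map_mul, map_mul, aeval_monomial_add_single h3, aeval_X, aeval_X, h]
      simp
      ring
  conv_lhs => rw [p.as_sum, map_sum, Finset.sum_congr rfl hmono, Finset.sum_add_distrib,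
    ← Finset.mul_sum, ← map_sum, ← map_sum, ← map_sum, ← p.as_sum]

theorem eval_add_single {p : MvPolynomial σ ℝ} (hp : Multiaffine p) (i : σ) (x : σ → ℝ) (t : ℝ) :
    eval (x + Pi.single i t) p = eval x p + t * eval x (pderiv i p) := by
  have := aeval_add_single hp i x t
  simpa [coe_aeval_eq_eval] using this

end MultiaffineBasics

/-! ### Half plane maps, the Rayleigh inequality and stability of ∂ₓp + ∂ᵧp -/

section Stability

variable {σ : Type*}

theorem aeval_ofReal (p : MvPolynomial σ ℝ) (x : σ → ℝ) :
    aeval (fun i => (x i : ℂ)) p = ((eval x p : ℝ) : ℂ) := by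
  have := aeval_algebraMap_apply ℂ x p
  simpa [Function.comp_def, coe_aeval_eq_eval] using this

theorem aeval_conj (p : MvPolynomial σ ℝ) (z : σ → ℂ) :
    aeval (fun i => starRingEnd ℂ (z i)) p = starRingEnd ℂ (aeval z p) :=
  (comp_aeval_apply z (Complex.conjAe : ℂ →ₐ[ℝ] ℂ) p).symm

theorem continuous_aeval_complex (p : MvPolynomial σ ℝ) :
    Continuous fun z : σ → ℂ => aeval z p := by
  simp only [aeval_def, eval₂_eq_eval_map]
  exact MvPolynomial.continuous_eval _

/-- Along direction i the polynomial is A + tB, with zero t = -A/B. If Im(B conj A) were positive,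
this shift would stay in the upper half plane. -/
theorem RealStable.im_pderiv_mul_conj_nonpos {p : MvPolynomial σ ℝ} (hp : RealStable p)
    (hp1 : Multiaffine p) (i : σ) (z : σ → ℂ) (hz : ∀ l, 0 < (z l).im) :
    (aeval z (pderiv i p) * starRingEnd ℂ (aeval z p)).im ≤ 0 := by
  classical
  set A := aeval z p
  set B := aeval z (pderiv i p) with hB
  by_contra! hpos
  have hB0 : B ≠ 0 := by
    intro h; rw [h] at hpos; simp at hpos
  have hN : 0 < Complex.normSq B := Complex.normSq_pos.mpr hB0
  refine hp (z + Pi.single i (-A / B)) (fun l => ?_) ?_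
  · by_cases h : l = i
    · subst h
      have h1 : (-A / B).im = (B * starRingEnd ℂ A).im / Complex.normSq B := by
        rw [Complex.div_im]
        simp only [Complex.mul_im, Complex.conj_re, Complex.conj_im, Complex.neg_re,
          Complex.neg_im]
        field_simp
        ring
      have h2 : 0 < (-A / B).im := by rw [h1]; positivity
      simpa using add_pos (hz l) h2
    · simpa [h] using hz l
  · rw [aeval_add_single hp1, ← hB]
    field_simp
    ring

/-- The passage to the closed half planes is needed because the Rayleigh inequality is read off at
points with all but one coordinate real. -/
theorem RealStable.im_pderiv_mul_conj_nonpos_of_nonneg {p : MvPolynomial σ ℝ} (hp : RealStable p)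
    (hp1 : Multiaffine p) (i : σ) (z : σ → ℂ) (hz : ∀ l, 0 ≤ (z l).im) :
    (aeval z (pderiv i p) * starRingEnd ℂ (aeval z p)).im ≤ 0 := by
  have hc : Continuous fun ε : ℝ => fun l => z l + ε * Complex.I := by fun_prop
  have hc2 : Continuous fun ε : ℝ =>
      (aeval (fun l => z l + ε * Complex.I) (pderiv i p) *
        starRingEnd ℂ (aeval (fun l => z l + ε * Complex.I) p)).im :=
    Complex.continuous_im.comp (((continuous_aeval_complex _).comp hc).mul
      (Complex.continuous_conj.comp ((continuous_aeval_complex _).comp hc)))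
  have ht := (hc2.tendsto 0).mono_left (nhdsWithin_le_nhds (s := Set.Ioi 0))
  have h := le_of_tendsto ht (by
    filter_upwards [self_mem_nhdsWithin] with ε hε
    exact hp.im_pderiv_mul_conj_nonpos hp1 i _ fun l => by
      simpa using add_pos_of_nonneg_of_pos (hz l) hε)
  simpa using h

/-- The Rayleigh inequality of a multiaffine real stable polynomial. -/
theorem RealStable.rayleigh {p : MvPolynomial σ ℝ} (hp : RealStable p) (hp1 : Multiaffine p)
    (i j : σ) (x : σ → ℝ) :
    eval x p * eval x (pderiv j (pderiv i p)) ≤ eval x (pderiv i p) * eval x (pderiv j p) := by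
  classical
  -- At x + i e_j both factors are affine in the imaginary unit, and the imaginary part of the
  -- product is p ∂_j∂_i p - ∂_i p ∂_j p.
  have h := hp.im_pderiv_mul_conj_nonpos_of_nonneg hp1 i
    ((fun l => (x l : ℂ)) + Pi.single j Complex.I) (fun l => by
      by_cases h : l = j
      · subst h; simp
      · simp [h])
  rw [aeval_add_single hp1, aeval_add_single (hp1.pderiv i), aeval_ofReal, aeval_ofReal,
    aeval_ofReal, aeval_ofReal] at h
  simp at h
  linarith

/-- For small t the sign is that of Im(t B conj C), and the direction t = i conj(B) C makes this
|B|²|C|². -/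
theorem eq_zero_of_im_mul_conj_nonpos {B C D : ℂ} (hC : C ≠ 0) {r : ℝ} (hr : 0 < r)
    (h : ∀ t : ℂ, ‖t‖ < r → (t * B * starRingEnd ℂ (C + t * D)).im ≤ 0) : B = 0 := by
  by_contra hB
  set u : ℂ := Complex.I * starRingEnd ℂ B * C with hu
  have hf : Filter.Tendsto (fun ε : ℝ => (u * B * starRingEnd ℂ (C + ε * u * D)).im)
      (nhdsWithin 0 (Set.Ioi 0)) (nhds (u * B * starRingEnd ℂ (C + ((0 : ℝ) : ℂ) * u * D)).im) := by
    refine Filter.Tendsto.mono_left (Continuous.tendsto ?_ 0) nhdsWithin_le_nhds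
    fun_prop
  have hle := le_of_tendsto hf (b := 0) (by
    have h1 : ∀ᶠ ε : ℝ in nhdsWithin 0 (Set.Ioi 0), ‖(ε : ℂ) * u‖ < r := by
      have : Filter.Tendsto (fun ε : ℝ => ‖(ε : ℂ) * u‖) (nhdsWithin 0 (Set.Ioi 0))
          (nhds ‖((0 : ℝ) : ℂ) * u‖) :=
        Filter.Tendsto.mono_left (Continuous.tendsto (by fun_prop) 0) nhdsWithin_le_nhds
      exact this.eventually_lt_const (by simpa using hr)
    filter_upwards [h1, self_mem_nhdsWithin] with ε h1 hε
    have h2 := h _ h1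
    rw [mul_assoc, mul_assoc, Complex.im_ofReal_mul, ← mul_assoc] at h2
    exact nonpos_of_mul_nonpos_right h2 hε)
  have h3 : (u * B * starRingEnd ℂ (C + ((0 : ℝ) : ℂ) * u * D)).im =
      Complex.normSq B * Complex.normSq C := by
    have : u * B * starRingEnd ℂ (C + ((0 : ℝ) : ℂ) * u * D) =
        ((Complex.normSq B * Complex.normSq C : ℝ) : ℂ) * Complex.I := by
      push_cast
      rw [← Complex.mul_conj, ← Complex.mul_conj, hu]
      simp
      ring
    rw [this, Complex.im_ofReal_mul]
    simp
  rw [h3] at hle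
  exact absurd hle (not_le.mpr (mul_pos (Complex.normSq_pos.mpr hB) (Complex.normSq_pos.mpr hC)))

/-- If `q / p` maps the product of upper half planes to the closed lower half plane, then `q` is
stable. -/
theorem RealStable.of_im_mul_conj_nonpos [Fintype σ] {p q : MvPolynomial σ ℝ} (hp : RealStable p)
    (hp1 : Multiaffine p) (hq1 : Multiaffine q) (hq : q ≠ 0)
    (h : ∀ z : σ → ℂ, (∀ i, 0 < (z i).im) →
      (aeval z q * starRingEnd ℂ (aeval z p)).im ≤ 0) : RealStable q := by
  classical
  intro z hz h0
  -- A zero of q spreads along every coordinate line, because the slope must vanish. Changing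
  -- coordinates one by one, q vanishes on the whole product of half planes, hence identically.
  have hstep : ∀ z : σ → ℂ, (∀ i, 0 < (z i).im) → aeval z q = 0 → ∀ i t,
      aeval (z + Pi.single i t) q = 0 := by
    intro z hz h0 i t
    rw [aeval_add_single hq1, h0, zero_add]
    have : aeval z (pderiv i q) = 0 := by
      refine eq_zero_of_im_mul_conj_nonpos (hp z hz) (D := aeval z (pderiv i p)) (hz i) ?_
      intro s hs
      have h1 := h (z + Pi.single i s) (fun l => by
        by_cases hl : l = i
        · subst hl
          have := (abs_le.mp (Complex.abs_im_le_norm s)).1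
          have h2 : 0 < (z l).im + s.im := by linarith
          simpa using h2
        · simpa [hl] using hz l)
      rw [aeval_add_single hq1, aeval_add_single hp1, h0, zero_add] at h1
      exact h1
    rw [this, mul_zero]
  have hall : ∀ w : σ → ℂ, (∀ i, 0 < (w i).im) → aeval w q = 0 := by
    intro w hw
    have hS : ∀ S : Finset σ, aeval (fun l => if l ∈ S then w l else z l) q = 0 := by
      intro S
      induction S using Finset.induction_on with
      | empty => simpa using h0
      | insert i S hi ih =>
        have := hstep (fun l => if l ∈ S then w l else z l)
          (fun l => by split_ifs; exacts [hw l, hz l]) ih i (w i - z i)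
        convert this using 3
        funext l
        by_cases hl : l = i
        · subst hl; simp [hi]
        · simp [hl]
    simpa using hS Finset.univ
  refine hq ?_
  have hmap : map (algebraMap ℝ ℂ) q = 0 := by
    refine funext_set (fun _ => {w : ℂ | 0 < w.im}) (fun _ => ?_) fun w hw => ?_
    · refine Set.infinite_of_injective_forall_mem (f := fun n : ℕ => ((n : ℂ) + Complex.I)) ?_ ?_
      · intro a b hab
        simpa using hab
      · intro n; simp
    · have := hall w fun i => hw i (Set.mem_univ i)
      rw [aeval_def, eval₂_eq_eval_map] at this
      rw [this, map_zero]
  exact (map_eq_zero_iff _ (map_injective _ (algebraMap ℝ ℂ).injective)).mp hmap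

theorem RealStable.pderiv_add_pderiv [Fintype σ] {p : MvPolynomial σ ℝ} (hp : RealStable p)
    (hp1 : Multiaffine p) (i j : σ) (h : pderiv i p + pderiv j p ≠ 0) :
    RealStable (pderiv i p + pderiv j p) := by
  refine hp.of_im_mul_conj_nonpos hp1 ((hp1.pderiv i).add (hp1.pderiv j)) h fun z hz => ?_
  rw [map_add, add_mul, Complex.add_im]
  exact add_nonpos (hp.im_pderiv_mul_conj_nonpos hp1 i z hz)
    (hp.im_pderiv_mul_conj_nonpos hp1 j z hz)

end Stability

/-! ### Potentials and the barrier step for ∂ₓ + ∂ᵧ -/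

section Barrier

variable {σ : Type*}

theorem AboveRoots.eval_ne_zero {v : σ → ℝ} {p : MvPolynomial σ ℝ} (h : AboveRoots v p) :
    eval v p ≠ 0 := by
  simpa using h 0 fun _ => le_rfl

theorem AboveRoots.add {v : σ → ℝ} {p : MvPolynomial σ ℝ} (h : AboveRoots v p) {t : σ → ℝ}
    (ht : ∀ i, 0 ≤ t i) : AboveRoots (v + t) p := by
  intro s hs
  rw [add_assoc]
  exact h _ fun i => add_nonneg (ht i) (hs i)

theorem single_nonneg_apply [DecidableEq σ] (i : σ) {s : ℝ} (hs : 0 ≤ s) (l : σ) :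
    0 ≤ (Pi.single i s : σ → ℝ) l := by
  by_cases h : l = i
  · subst h; simpa using hs
  · simp [h]

/-- Along direction i, p is p(v)(1 + s · potential), and a negative potential would give a root at a
positive s. -/
theorem potential_nonneg {v : σ → ℝ} {p : MvPolynomial σ ℝ} (hp1 : Multiaffine p)
    (h : AboveRoots v p) (i : σ) : 0 ≤ potential i p v := by
  classical
  by_contra! hneg
  have h0 := h.eval_ne_zero
  have hB : potential i p v ≠ 0 := hneg.ne
  have := h (Pi.single i (-(potential i p v)⁻¹))
    (single_nonneg_apply i (by rw [neg_nonneg]; exact (inv_lt_zero.mpr hneg).le))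
  rw [eval_add_single hp1] at this
  refine this ?_
  have hB' : eval v (pderiv i p) ≠ 0 := fun hz => hB (by rw [potential, hz, zero_div])
  rw [potential]
  field_simp
  ring

/-- The potentials along a coordinate ray. -/
theorem potential_add_single [DecidableEq σ] {v : σ → ℝ} {p : MvPolynomial σ ℝ}
    (hp1 : Multiaffine p) (h : AboveRoots v p) (i j : σ) (s : ℝ) :
    potential i p (v + Pi.single j s) =
      (potential i p v + s * (eval v (pderiv j (pderiv i p)) / eval v p)) /
        (1 + s * potential j p v) := by
  have h0 := h.eval_ne_zero
  rw [potential, eval_add_single hp1, eval_add_single (hp1.pderiv i), potential, potential,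
    ← mul_div_mul_left _ (1 + s * (eval v (pderiv j p) / eval v p)) h0]
  congr 1 <;> field_simp

theorem second_quotient_nonneg {v : σ → ℝ} {p : MvPolynomial σ ℝ} (hp1 : Multiaffine p)
    (h : AboveRoots v p) (i j : σ) : 0 ≤ eval v (pderiv j (pderiv i p)) / eval v p := by
  classical
  by_contra! hneg
  set d := eval v (pderiv j (pderiv i p)) / eval v p
  set b := potential i p v
  have hb : 0 ≤ b := potential_nonneg hp1 h i
  have hc : 0 ≤ potential j p v := potential_nonneg hp1 h j
  -- At this distance in direction j the numerator b + s d of the potential equals -1, although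
  -- potentials stay nonnegative above the roots.
  have hs : 0 ≤ (b + 1) / (-d) := div_nonneg (by linarith) (by linarith)
  have h1 := potential_nonneg hp1 (h.add (single_nonneg_apply j hs)) i
  rw [potential_add_single hp1 h] at h1
  have h2 : 0 < 1 + (b + 1) / (-d) * potential j p v := by positivity
  have h3 := (div_nonneg_iff.mp h1).resolve_right fun h => absurd h.2 (not_le.mpr h2)
  have h4 : b + (b + 1) / (-d) * d = -1 := by
    have : d ≠ 0 := hneg.ne
    field_simp
    ring
  have h5 := h3.1
  change 0 ≤ b + (b + 1) / (-d) * d at h5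
  rw [h4] at h5
  linarith

theorem second_quotient_le {p : MvPolynomial σ ℝ} (hp : RealStable p) (hp1 : Multiaffine p)
    {v : σ → ℝ} (h0 : eval v p ≠ 0) (i j : σ) :
    eval v (pderiv j (pderiv i p)) / eval v p ≤ potential i p v * potential j p v := by
  have h1 := hp.rayleigh hp1 i j v
  have h2 : 0 < eval v p ^ 2 := by positivity
  rw [potential, potential, div_mul_div_comm, ← sq, le_div_iff₀ h2]
  calc _ = eval v p * eval v (pderiv j (pderiv i p)) := by field_simp
    _ ≤ _ := h1

theorem potential_add_single_le [DecidableEq σ] {p : MvPolynomial σ ℝ} (hp : RealStable p)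
    (hp1 : Multiaffine p) {v : σ → ℝ} (h : AboveRoots v p) (i j : σ) {s : ℝ} (hs : 0 ≤ s) :
    potential i p (v + Pi.single j s) ≤ potential i p v := by
  have hb := potential_nonneg hp1 h i
  have hc := potential_nonneg hp1 h j
  have hd := second_quotient_le hp hp1 h.eval_ne_zero i j
  rw [potential_add_single hp1 h, div_le_iff₀ (by positivity)]
  nlinarith [mul_le_mul_of_nonneg_left hd hs]

/-- Potentials are nonincreasing above the roots. -/
theorem potential_add_le [Fintype σ] {p : MvPolynomial σ ℝ} (hp : RealStable p)
    (hp1 : Multiaffine p) {v : σ → ℝ} (h : AboveRoots v p) (i : σ) {t : σ → ℝ}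
    (ht : ∀ i, 0 ≤ t i) : potential i p (v + t) ≤ potential i p v := by
  classical
  have hS : ∀ S : Finset σ,
      potential i p (v + ∑ j ∈ S, Pi.single j (t j)) ≤ potential i p v := by
    intro S
    induction S using Finset.induction_on with
    | empty => simp
    | insert j S hj ih =>
      rw [Finset.sum_insert hj, add_left_comm, add_comm]
      refine (potential_add_single_le hp hp1 (h.add fun l => ?_) i j (ht j)).trans ih
      rw [Finset.sum_apply]
      exact Finset.sum_nonneg fun j _ => single_nonneg_apply j (ht j) l
  simpa [Finset.univ_sum_single] using hS Finset.univ

/-- Potentials are nonnegative and nonincreasing, so a vanishing sum would vanish on the whole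
orthant above v, and ∂ₓp + ∂ᵧp with it. -/
theorem potential_add_potential_pos [Fintype σ] {p : MvPolynomial σ ℝ} (hp : RealStable p)
    (hp1 : Multiaffine p) {v : σ → ℝ} (h : AboveRoots v p) {x y : σ}
    (hT : pderiv x p + pderiv y p ≠ 0) : 0 < potential x p v + potential y p v := by
  by_contra! hle
  refine hT (funext_set (fun i => Set.Ici (v i)) (fun i => Set.Ici_infinite _) fun u hu => ?_)
  have ht : ∀ i, 0 ≤ (u - v) i := fun i => by
    simpa using hu i (Set.mem_univ i)
  have huv : v + (u - v) = u := add_sub_cancel _ _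
  have hau := h.add ht
  have hx := potential_add_le hp hp1 h x ht
  have hy := potential_add_le hp hp1 h y ht
  have hx0 := potential_nonneg hp1 h x
  have hy0 := potential_nonneg hp1 h y
  have hx1 := potential_nonneg hp1 hau x
  have hy1 := potential_nonneg hp1 hau y
  rw [huv] at hau hx hy hx1 hy1
  have h0 := hau.eval_ne_zero
  have hx2 : potential x p u = 0 := by linarith
  have hy2 : potential y p u = 0 := by linarith
  rw [potential, div_eq_zero_iff] at hx2 hy2
  rw [map_add, hx2.resolve_right h0, hy2.resolve_right h0]
  simp

theorem eval_pderiv_add_pderiv_sub_single [DecidableEq σ] {p : MvPolynomial σ ℝ}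
    (hp1 : Multiaffine p) (x y : σ) (v : σ → ℝ) (δ : ℝ) :
    eval (v - Pi.single x δ) (pderiv x p + pderiv y p) =
      eval v (pderiv x p) + eval v (pderiv y p) - δ * eval v (pderiv x (pderiv y p)) := by
  rw [sub_eq_add_neg, ← Pi.single_neg, eval_add_single ((hp1.pderiv x).add (hp1.pderiv y)),
    map_add, map_add, hp1.pderiv_pderiv_self x, zero_add]
  ring

/-- As ∂ₓ²p = 0, the value divided by p is b + c - δd. Here d ≤ bc by Rayleigh, and δbc ≤ bc/(b + c)
< b + c, so it is positive. Monotone potentials keep δ(b + c) ≤ 1 throughout the orthant. -/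
theorem AboveRoots.pderiv_add_pderiv [Fintype σ] [DecidableEq σ] {p : MvPolynomial σ ℝ}
    (hp : RealStable p) (hp1 : Multiaffine p) {v : σ → ℝ} (h : AboveRoots v p) {x y : σ}
    (hT : pderiv x p + pderiv y p ≠ 0) {δ : ℝ} (hδ : 0 ≤ δ)
    (hδ1 : δ * (potential x p v + potential y p v) ≤ 1) :
    AboveRoots (v - Pi.single x δ) (pderiv x p + pderiv y p) := by
  intro t ht
  have hu := h.add ht
  have h0 := hu.eval_ne_zero
  have hx := potential_add_le hp hp1 h x ht
  have hy := potential_add_le hp hp1 h y ht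
  have hpos := potential_add_potential_pos hp hp1 hu hT
  have hx0 := potential_nonneg hp1 hu x
  have hy0 := potential_nonneg hp1 hu y
  have hd := second_quotient_le hp hp1 h0 y x
  rw [sub_add_eq_add_sub, eval_pderiv_add_pderiv_sub_single hp1]
  set u := v + t
  have heq : eval u (pderiv x p) + eval u (pderiv y p) - δ * eval u (pderiv x (pderiv y p)) =
      eval u p * (potential x p u + potential y p u -
        δ * (eval u (pderiv x (pderiv y p)) / eval u p)) := by
    rw [potential, potential]; field_simp
  rw [heq]
  refine mul_ne_zero h0 (ne_of_gt ?_)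
  set b := potential x p u
  set c := potential y p u
  set d := eval u (pderiv x (pderiv y p)) / eval u p
  have h1 : δ * (b + c) ≤ 1 :=
    (mul_le_mul_of_nonneg_left (add_le_add hx hy) hδ).trans hδ1
  have h2 : δ * d ≤ δ * (c * b) := mul_le_mul_of_nonneg_left hd hδ
  have h3 : δ * (c * b) * (b + c) ≤ c * b := by
    calc _ = (δ * (b + c)) * (c * b) := by ring
      _ ≤ 1 * (c * b) := mul_le_mul_of_nonneg_right h1 (mul_nonneg hy0 hx0)
      _ = c * b := one_mul _
  have h4 : c * b < (b + c) * (b + c) := by nlinarith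
  have h5 : δ * (c * b) < b + c := lt_of_mul_lt_mul_right (h3.trans_lt h4) hpos.le
  linarith

/-- By AM–GM, τ² ≤ 4bcβγ ≤ (βb + γc)², so -τ ≤ βb + γc; then β + γ ≥ δ(b + c)(β + γ) is expanded. -/
theorem barrier_inequality {b c α β γ τ δ : ℝ} (hb : 0 ≤ b) (hc : 0 ≤ c)
    (hβ : 0 ≤ β) (hγ : 0 ≤ γ) (hαbc : α ≤ b * c) (hτ : τ ^ 2 ≤ 4 * α * β * γ)
    (hδ : 0 ≤ δ) (hδ1 : δ * (b + c) ≤ 1) : δ * (β * c + γ * b) ≤ β + γ + δ * τ := by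
  have h1 : τ ^ 2 ≤ (β * b + γ * c) ^ 2 := by
    have := mul_le_mul_of_nonneg_right hαbc (mul_nonneg hβ hγ)
    nlinarith [sq_nonneg (β * b - γ * c)]
  have h2 := (abs_le.mp (abs_le_of_sq_le_sq h1 (by positivity))).1
  have h3 := mul_le_mul_of_nonneg_right hδ1 (add_nonneg hβ hγ)
  have h4 := mul_nonneg hδ (show 0 ≤ β * b + γ * c + τ by linarith)
  nlinarith

/-- Applying `∂ₓ + ∂ᵧ` and moving down by `δ` does not increase the potentials in the other
directions. -/
theorem potential_pderiv_add_pderiv_le [Fintype σ] [DecidableEq σ] {p : MvPolynomial σ ℝ}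
    (hp : RealStable p) (hp1 : Multiaffine p) {v : σ → ℝ} (h : AboveRoots v p) {x y : σ}
    (hT : pderiv x p + pderiv y p ≠ 0) {δ : ℝ} (hδ : 0 ≤ δ)
    (hδ1 : δ * (potential x p v + potential y p v) ≤ 1) (w : σ) :
    potential w (pderiv x p + pderiv y p) (v - Pi.single x δ) ≤ potential w p v := by
  have h0 := h.eval_ne_zero
  have hb := potential_nonneg hp1 h x
  have hc := potential_nonneg hp1 h y
  have hd := second_quotient_nonneg hp1 h y x
  have hα := second_quotient_le hp hp1 h0 y x
  have hβ := second_quotient_le hp hp1 h0 x w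
  have hγ := second_quotient_le hp hp1 h0 y w
  have hpos := potential_add_potential_pos hp hp1 h hT
  -- The Rayleigh difference for x and y along direction w: a quadratic in s that is nonnegative on
  -- the whole line, since Rayleigh holds at every real point.
  have hray : ∀ s : ℝ, 0 ≤
      (eval v (pderiv x p) + s * eval v (pderiv w (pderiv x p))) *
        (eval v (pderiv y p) + s * eval v (pderiv w (pderiv y p))) -
      (eval v p + s * eval v (pderiv w p)) *
        (eval v (pderiv x (pderiv y p)) + s * eval v (pderiv w (pderiv x (pderiv y p)))) := by
    intro s
    have := hp.rayleigh hp1 y x (v + Pi.single w s)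
    rw [eval_add_single hp1, eval_add_single (hp1.pderiv x), eval_add_single (hp1.pderiv y),
      eval_add_single ((hp1.pderiv y).pderiv x)] at this
    linarith
  have hnum : eval (v - Pi.single x δ) (pderiv w (pderiv x p + pderiv y p)) =
      eval v (pderiv w (pderiv x p)) + eval v (pderiv w (pderiv y p)) -
        δ * eval v (pderiv w (pderiv x (pderiv y p))) := by
    rw [map_add, pderiv_pderiv_comm w x, pderiv_pderiv_comm w y,
      eval_pderiv_add_pderiv_sub_single (hp1.pderiv w), pderiv_pderiv_comm y w,
      pderiv_pderiv_comm x w, pderiv_pderiv_comm x w]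
  rw [potential, hnum, eval_pderiv_add_pderiv_sub_single hp1]
  have hxe : eval v (pderiv x p) = eval v p * potential x p v := by
    rw [potential]; field_simp
  have hye : eval v (pderiv y p) = eval v p * potential y p v := by
    rw [potential]; field_simp
  have hwe : eval v (pderiv w p) = eval v p * potential w p v := by
    rw [potential]; field_simp
  obtain ⟨d, hde⟩ : ∃ d, d = eval v (pderiv x (pderiv y p)) / eval v p := ⟨_, rfl⟩
  obtain ⟨bw, hbw⟩ : ∃ d, d = eval v (pderiv w (pderiv x p)) / eval v p := ⟨_, rfl⟩
  obtain ⟨cw, hcw⟩ : ∃ d, d = eval v (pderiv w (pderiv y p)) / eval v p := ⟨_, rfl⟩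
  obtain ⟨dw, hdw⟩ : ∃ d, d = eval v (pderiv w (pderiv x (pderiv y p))) / eval v p := ⟨_, rfl⟩
  rw [← hde] at hd hα
  rw [← hbw] at hβ
  rw [← hcw] at hγ
  rw [eq_div_iff h0, mul_comm] at hde hbw hcw hdw
  simp only [hxe, hye, hwe, ← hde, ← hbw, ← hcw, ← hdw] at hray ⊢
  generalize potential x p v = b at *
  generalize potential y p v = c at *
  generalize potential w p v = e at *
  generalize eval v p = A at *
  have hdisc : discrim (bw * cw - e * dw) (b * cw + bw * c - dw - e * d) (b * c - d) ≤ 0 := by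
    refine discrim_le_zero fun s => ?_
    have hA : 0 < A ^ 2 := by positivity
    refine nonneg_of_mul_nonneg_right ?_ hA
    have := hray s
    linarith
  -- The discriminant in terms of the Rayleigh defects α = bc - d, β = be - bw, γ = ce - cw. With τ
  -- the squared quantity, dw - ed = τ - βc - γb, so the goal becomes `barrier_inequality`.
  have hτ : (dw - b * c * e + (b * c - d) * e + (b * e - bw) * c + (c * e - cw) * b) ^ 2 ≤
      4 * (b * c - d) * (b * e - bw) * (c * e - cw) := by
    rw [discrim] at hdisc
    linarith
  have hmain := barrier_inequality hb hc (sub_nonneg.mpr hβ) (sub_nonneg.mpr hγ)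
    (show b * c - d ≤ b * c by linarith) hτ hδ hδ1
  have hden : 0 < b + c - δ * d := by
    have h2 : δ * d ≤ δ * (c * b) := mul_le_mul_of_nonneg_left hα hδ
    have h3 : δ * (c * b) * (b + c) ≤ c * b := by
      calc _ = (δ * (b + c)) * (c * b) := by ring
        _ ≤ 1 * (c * b) := mul_le_mul_of_nonneg_right hδ1 (mul_nonneg hc hb)
        _ = c * b := one_mul _
    have h4 : c * b < (b + c) * (b + c) := by nlinarith
    have h5 : δ * (c * b) < b + c := lt_of_mul_lt_mul_right (h3.trans_lt h4) hpos.le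
    linarith
  have heq : (A * bw + A * cw - δ * (A * dw)) / (A * b + A * c - δ * (A * d)) =
      (bw + cw - δ * dw) / (b + c - δ * d) := by
    rw [← mul_div_mul_left (bw + cw - δ * dw) _ h0]
    congr 1 <;> ring
  rw [heq, div_le_iff₀ hden]
  linarith

end Barrier

/-! ### Iterating the barrier step over all pairs of variables -/

section Iteration

variable {E : Type*}

/-- The derivation `∂_{x_e} + ∂_{y_e}` on polynomials in two copies of the variables. -/
noncomputable def sumDeriv (e : E) :
    Derivation ℝ (MvPolynomial (E ⊕ E) ℝ) (MvPolynomial (E ⊕ E) ℝ) :=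
  pderiv (Sum.inl e) + pderiv (Sum.inr e)

theorem sumDeriv_apply (e : E) (P : MvPolynomial (E ⊕ E) ℝ) :
    sumDeriv e P = pderiv (Sum.inl e) P + pderiv (Sum.inr e) P := rfl

/-- The composition of the operators `∂_{x_e} + ∂_{y_e}` along a list. -/
noncomputable def iterSumDeriv (l : List E) : Module.End ℝ (MvPolynomial (E ⊕ E) ℝ) :=
  (l.map fun e => (sumDeriv e).toLinearMap).prod

theorem iterSumDeriv_nil (P : MvPolynomial (E ⊕ E) ℝ) : iterSumDeriv [] P = P := by
  simp [iterSumDeriv]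

theorem iterSumDeriv_cons (e : E) (l : List E) (P : MvPolynomial (E ⊕ E) ℝ) :
    iterSumDeriv (e :: l) P = sumDeriv e (iterSumDeriv l P) := by
  simp [iterSumDeriv]

/-- The point `v`, lowered by `δ e` in the coordinates `x_e` for `e` in the list. -/
def lowered [DecidableEq E] (v : E ⊕ E → ℝ) (δ : E → ℝ) (l : List E) : E ⊕ E → ℝ :=
  Sum.elim (fun e => v (Sum.inl e) - if e ∈ l then δ e else 0) fun e => v (Sum.inr e)

theorem lowered_nil [DecidableEq E] (v : E ⊕ E → ℝ) (δ : E → ℝ) : lowered v δ [] = v := by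
  funext e
  rcases e with e | e <;> simp [lowered]

theorem lowered_cons [DecidableEq E] (v : E ⊕ E → ℝ) (δ : E → ℝ) {e : E} {l : List E}
    (h : e ∉ l) : lowered v δ (e :: l) = lowered v δ l - Pi.single (Sum.inl e) (δ e) := by
  funext i
  rcases i with i | i
  · by_cases hi : i = e
    · subst hi; simp [lowered, h]
    · simp [lowered, hi]
  · simp [lowered]

/-- The barrier argument, one pair of variables after the other. -/
theorem iterSumDeriv_barrier [Fintype E] [DecidableEq E] {P : MvPolynomial (E ⊕ E) ℝ}
    (hP : RealStable P) (hP1 : Multiaffine P) {v : E ⊕ E → ℝ} (hv : AboveRoots v P)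
    {φ : E → ℝ} (hφ : ∀ e, φ e = potential (Sum.inl e) P v + potential (Sum.inr e) P v)
    (l : List E) (hl : l.Nodup) (hne : iterSumDeriv l P ≠ 0) :
    RealStable (iterSumDeriv l P) ∧ Multiaffine (iterSumDeriv l P) ∧ (∀ e ∈ l, 0 < φ e) ∧
      AboveRoots (lowered v (fun e => 1 / φ e) l) (iterSumDeriv l P) ∧
      ∀ w, potential w (iterSumDeriv l P) (lowered v (fun e => 1 / φ e) l) ≤
        potential w P v := by
  induction l with
  | nil =>
    rw [lowered_nil, iterSumDeriv_nil]
    exact ⟨hP, hP1, by simp, hv, fun _ => le_rfl⟩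
  | cons e l ih =>
    rw [List.nodup_cons] at hl
    rw [iterSumDeriv_cons] at hne ⊢
    obtain ⟨hS, hS1, hpos, hab, hpot⟩ := ih hl.2 fun h => hne (by rw [h, map_zero])
    rw [lowered_cons _ _ hl.1]
    rw [sumDeriv_apply] at hne ⊢
    have h1 := potential_add_potential_pos hS hS1 hab hne
    -- The current potentials are bounded by the initial ones, so the step 1/φ_e fixed at the start
    -- satisfies δ(b + c) ≤ 1.
    have h2 : potential (Sum.inl e) (iterSumDeriv l P) (lowered v (fun e => 1 / φ e) l) +
        potential (Sum.inr e) (iterSumDeriv l P) (lowered v (fun e => 1 / φ e) l) ≤ φ e := by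
      rw [hφ]
      exact add_le_add (hpot _) (hpot _)
    have hφe : 0 < φ e := h1.trans_le h2
    have hδ : 0 ≤ 1 / φ e := by positivity
    have hδ1 := mul_le_mul_of_nonneg_left h2 hδ
    rw [one_div_mul_cancel hφe.ne'] at hδ1
    refine ⟨hS.pderiv_add_pderiv hS1 _ _ hne, (hS1.pderiv _).add (hS1.pderiv _), ?_,
      hab.pderiv_add_pderiv hS hS1 hne hδ hδ1, fun w =>
        (potential_pderiv_add_pderiv_le hS hS1 hab hne hδ hδ1 w).trans (hpot w)⟩
    intro e' he'
    rcases List.mem_cons.mp he' with rfl | h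
    · exact hφe
    · exact hpos e' h

end Iteration

/-! ### Products f(x) g(y) in disjoint sets of variables -/

section SeparatedProduct

variable {E : Type*}

theorem RealStable.separatedProduct {f g : MvPolynomial E ℝ} (hf : RealStable f)
    (hg : RealStable g) : RealStable (rename Sum.inl f * rename (Sum.inr : E → E ⊕ E) g) := by
  intro z hz
  rw [map_mul, aeval_rename, aeval_rename]
  exact mul_ne_zero (hf _ fun i => hz _) (hg _ fun i => hz _)

theorem pderiv_inl_rename_inr (e : E) (g : MvPolynomial E ℝ) :
    pderiv (Sum.inl e) (rename (Sum.inr : E → E ⊕ E) g) = 0 := by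
  classical
  refine pderiv_eq_zero_of_notMem_vars fun h => ?_
  simpa using vars_rename _ _ h

theorem pderiv_inr_rename_inl (e : E) (g : MvPolynomial E ℝ) :
    pderiv (Sum.inr e) (rename (Sum.inl : E → E ⊕ E) g) = 0 := by
  classical
  refine pderiv_eq_zero_of_notMem_vars fun h => ?_
  simpa using vars_rename _ _ h

theorem Multiaffine.separatedProduct {f g : MvPolynomial E ℝ} (hf : Multiaffine f)
    (hg : Multiaffine g) : Multiaffine (rename Sum.inl f * rename (Sum.inr : E → E ⊕ E) g) := by
  classical
  intro i
  refine (degreeOf_mul_le _ _ _).trans ?_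
  rcases i with e | e
  · rw [degreeOf_rename_of_injective Sum.inl_injective]
    have : degreeOf (Sum.inl e) (rename (Sum.inr : E → E ⊕ E) g) = 0 := by
      refine Nat.le_zero.mp (degreeOf_le_iff.mpr fun m hm => Nat.le_zero.mpr ?_)
      by_contra h0
      have := vars_rename _ _ ((mem_vars_iff_mem_support _).mpr ⟨m, hm, Finsupp.mem_support_iff.mpr h0⟩)
      simp at this
    rw [this]
    exact hf e
  · rw [degreeOf_rename_of_injective Sum.inr_injective]
    have : degreeOf (Sum.inr e) (rename (Sum.inl : E → E ⊕ E) f) = 0 := by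
      refine Nat.le_zero.mp (degreeOf_le_iff.mpr fun m hm => Nat.le_zero.mpr ?_)
      by_contra h0
      have := vars_rename _ _ ((mem_vars_iff_mem_support _).mpr ⟨m, hm, Finsupp.mem_support_iff.mpr h0⟩)
      simp at this
    rw [this, zero_add]
    exact hg e

theorem eval_separatedProduct (f g : MvPolynomial E ℝ) (x y : E → ℝ) :
    eval (Sum.elim x y) (rename Sum.inl f * rename Sum.inr g) = eval x f * eval y g := by
  rw [map_mul, eval_rename, eval_rename]
  rfl

theorem AboveRoots.separatedProduct {f g : MvPolynomial E ℝ} {a b : E → ℝ} (hf : AboveRoots a f)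
    (hg : AboveRoots b g) :
    AboveRoots (Sum.elim a b) (rename Sum.inl f * rename (Sum.inr : E → E ⊕ E) g) := by
  intro t ht
  have : Sum.elim a b + t = Sum.elim (a + t ∘ Sum.inl) (b + t ∘ Sum.inr) := by
    funext i; rcases i with i | i <;> rfl
  rw [this, eval_separatedProduct]
  exact mul_ne_zero (hf _ fun i => ht _) (hg _ fun i => ht _)

theorem potential_inl_separatedProduct {f g : MvPolynomial E ℝ} {a b : E → ℝ}
    (hg : eval b g ≠ 0) (e : E) :
    potential (Sum.inl e) (rename Sum.inl f * rename Sum.inr g) (Sum.elim a b) =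
      potential e f a := by
  rw [potential, pderiv_mul, pderiv_inl_rename_inr, mul_zero, add_zero,
    pderiv_rename Sum.inl_injective, eval_separatedProduct, eval_separatedProduct,
    mul_div_mul_right _ _ hg, potential]

theorem potential_inr_separatedProduct {f g : MvPolynomial E ℝ} {a b : E → ℝ}
    (hf : eval a f ≠ 0) (e : E) :
    potential (Sum.inr e) (rename Sum.inl f * rename Sum.inr g) (Sum.elim a b) =
      potential e g b := by
  rw [potential, pderiv_mul, pderiv_inr_rename_inl, zero_mul, zero_add,
    pderiv_rename Sum.inr_injective, eval_separatedProduct, eval_separatedProduct,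
    mul_div_mul_left _ _ hf, potential]

end SeparatedProduct

/-! ### Algebra of the operators q(∂) -/

section DiffOp

variable {E : Type*} [Fintype E]

theorem pairwise_commute_partialD_pow {σ : Type*} (s : σ → ℕ) (S : Set σ) :
    S.Pairwise (Function.onFun Commute fun i => partialD i ^ s i) :=
  fun i _ j _ _ => (partialD_commute i j).pow_pow (s i) (s j)

theorem monomialD_eq_noncommProd (s : E →₀ ℕ) :
    monomialD s = Finset.univ.noncommProd (fun i => partialD i ^ s i)
      (pairwise_commute_partialD_pow s _) := rfl

theorem monomialD_add (s t : E →₀ ℕ) : monomialD (s + t) = monomialD s * monomialD t := by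
  rw [monomialD_eq_noncommProd, monomialD_eq_noncommProd, monomialD_eq_noncommProd,
    ← Finset.noncommProd_mul_distrib (fun i => partialD i ^ s i) (fun i => partialD i ^ t i)
    (pairwise_commute_partialD_pow s _) (pairwise_commute_partialD_pow t _)
    (fun i _ j _ _ => (partialD_commute i j).pow_pow (t i) (s j))]
  refine Finset.noncommProd_congr rfl (fun i _ => ?_) _
  rw [Pi.mul_apply, ← pow_add, Finsupp.add_apply]

theorem monomialD_zero : monomialD (0 : E →₀ ℕ) = 1 := by
  rw [monomialD_eq_noncommProd, Finset.noncommProd_eq_pow_card (m := 1)]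
  · simp
  · intro i _; simp

theorem monomialD_single (e : E) : monomialD (Finsupp.single e 1) = partialD e := by
  classical
  have h : (Finset.univ : Finset E) = insert e (Finset.univ.erase e) :=
    (Finset.insert_erase (Finset.mem_univ e)).symm
  have h1 : monomialD (Finsupp.single e 1) =
      (insert e (Finset.univ.erase e)).noncommProd (fun i => partialD i ^ Finsupp.single e 1 i)
        (pairwise_commute_partialD_pow _ _) :=
    Finset.noncommProd_congr h (fun i _ => rfl) _
  rw [h1, Finset.noncommProd_insert_of_notMem _ _ _ _ (Finset.notMem_erase e _),
    Finset.noncommProd_eq_pow_card (m := 1)]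
  · simp
  · intro i hi
    simp [(Finset.ne_of_mem_erase hi).symm]

theorem diffOp_eq_sum {q : MvPolynomial E ℝ} {S : Finset (E →₀ ℕ)} (h : q.support ⊆ S)
    (p : MvPolynomial E ℝ) : diffOp q p = ∑ m ∈ S, coeff m q • monomialD m p := by
  refine Finset.sum_subset h fun m _ hm => ?_
  rw [notMem_support_iff.mp hm, zero_smul]

theorem diffOp_add_left (q q' p : MvPolynomial E ℝ) :
    diffOp (q + q') p = diffOp q p + diffOp q' p := by
  classical
  rw [diffOp_eq_sum (S := q.support ∪ q'.support) support_add,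
    diffOp_eq_sum (q := q) (S := q.support ∪ q'.support) Finset.subset_union_left,
    diffOp_eq_sum (q := q') (S := q.support ∪ q'.support) Finset.subset_union_right,
    ← Finset.sum_add_distrib]
  simp only [coeff_add, add_smul]

theorem diffOp_monomial (s : E →₀ ℕ) (c : ℝ) (p : MvPolynomial E ℝ) :
    diffOp (monomial s c) p = c • monomialD s p := by
  classical
  rw [diffOp_eq_sum (S := {s}) support_monomial_subset, Finset.sum_singleton, coeff_monomial,
    if_pos rfl]

theorem diffOp_sum_right {ι : Type*} (q : MvPolynomial E ℝ) (s : Finset ι)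
    (p : ι → MvPolynomial E ℝ) : diffOp q (∑ i ∈ s, p i) = ∑ i ∈ s, diffOp q (p i) := by
  simp only [diffOp, map_sum, Finset.smul_sum]
  exact Finset.sum_comm

theorem diffOp_sum_left {ι : Type*} (s : Finset ι) (q : ι → MvPolynomial E ℝ)
    (p : MvPolynomial E ℝ) : diffOp (∑ i ∈ s, q i) p = ∑ i ∈ s, diffOp (q i) p := by
  classical
  induction s using Finset.induction_on with
  | empty => simp [diffOp]
  | insert i s hi ih => rw [Finset.sum_insert hi, Finset.sum_insert hi, diffOp_add_left, ih]

theorem diffOp_mul_X (q p : MvPolynomial E ℝ) (e : E) :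
    diffOp (q * X e) p = diffOp q (pderiv e p) := by
  induction q using MvPolynomial.induction_on' with
  | monomial s c =>
    rw [X, monomial_mul, mul_one, diffOp_monomial, diffOp_monomial, monomialD_add,
      monomialD_single]
    rfl
  | add q q' h h' => rw [add_mul, diffOp_add_left, diffOp_add_left, h, h']

theorem diffOp_C (c : ℝ) (p : MvPolynomial E ℝ) : diffOp (C c) p = c • p := by
  change diffOp (monomial 0 c) p = _
  rw [diffOp_monomial, monomialD_zero]
  rfl

end DiffOp

/-! ### Derivations that see a single factor of a product -/

section ProductRule

variable {E : Type*} {A : Type*} [CommRing A] [Algebra ℝ A]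

theorem derivation_prod_eq_zero (D : Derivation ℝ A A) (S : Finset E) (M : E → A)
    (h : ∀ e ∈ S, D (M e) = 0) : D (∏ e ∈ S, M e) = 0 := by
  refine Finset.prod_induction M (fun a => D a = 0) (fun a b ha hb => ?_) (by simp) h
  simp [ha, hb]

theorem derivation_prod_univ [Fintype E] [DecidableEq E] (D : Derivation ℝ A A) (e : E) (M : E → A)
    (h : ∀ e' ≠ e, D (M e') = 0) :
    D (∏ e', M e') = ∏ e', if e' = e then D (M e') else M e' := by
  rw [← Finset.mul_prod_erase _ _ (Finset.mem_univ e), D.leibniz,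
    derivation_prod_eq_zero D _ M fun e' he' => h e' (Finset.ne_of_mem_erase he'),
    ← Finset.mul_prod_erase _ (fun e' => if e' = e then D (M e') else M e') (Finset.mem_univ e),
    Finset.prod_congr rfl (f := fun e' => if e' = e then D (M e') else M e') (g := M)
      fun e' he' => if_neg (Finset.ne_of_mem_erase he')]
  simp [mul_comm]

end ProductRule

/-! ### The flip and the convolution identity -/

section Flip

variable {E : Type*}

theorem sumDeriv_comm (e e' : E) (P : MvPolynomial (E ⊕ E) ℝ) :
    sumDeriv e (sumDeriv e' P) = sumDeriv e' (sumDeriv e P) := by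
  simp only [sumDeriv_apply, map_add]
  rw [pderiv_pderiv_comm (Sum.inl e) (Sum.inl e'), pderiv_pderiv_comm (Sum.inl e) (Sum.inr e'),
    pderiv_pderiv_comm (Sum.inr e) (Sum.inl e'), pderiv_pderiv_comm (Sum.inr e) (Sum.inr e')]
  ring

variable [Fintype E]

theorem monomial_one_eq_prod {τ : Type*} [Fintype τ] (m : τ →₀ ℕ) :
    (monomial m (1 : ℝ)) = ∏ e, X e ^ m e := by
  rw [monomial_eq, C_1, one_mul, Finsupp.prod_fintype _ _ fun _ => pow_zero _]

theorem iterSumDeriv_prod [DecidableEq E] (M : E → MvPolynomial (E ⊕ E) ℝ)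
    (h : ∀ e e', e' ≠ e → sumDeriv e (M e') = 0) (l : List E) (hl : l.Nodup) :
    iterSumDeriv l (∏ e, M e) = ∏ e, if e ∈ l then sumDeriv e (M e) else M e := by
  induction l with
  | nil => simp [iterSumDeriv_nil]
  | cons e l ih =>
    rw [List.nodup_cons] at hl
    rw [iterSumDeriv_cons, ih hl.2, derivation_prod_univ _ e]
    · refine Finset.prod_congr rfl fun e' _ => ?_
      by_cases he : e' = e
      · subst he; simp [hl.1]
      · simp [he]
    · intro e' he'
      split_ifs
      · rw [sumDeriv_comm, h e e' he', map_zero]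
      · exact h e e' he'

theorem monomialD_prod [DecidableEq E] (s : E →₀ ℕ) (hs : ∀ e, s e ≤ 1)
    (M : E → MvPolynomial E ℝ) (h : ∀ e e', e' ≠ e → pderiv e (M e') = 0) :
    monomialD s (∏ e, M e) = ∏ e, if s e = 0 then M e else pderiv e (M e) := by
  have hS : ∀ S : Finset E, S.noncommProd (fun i => partialD i ^ s i)
      (pairwise_commute_partialD_pow s _) (∏ e, M e) =
      ∏ e, if e ∈ S ∧ s e ≠ 0 then pderiv e (M e) else M e := by
    intro S
    induction S using Finset.induction_on with
    | empty => simp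
    | insert e S he ih =>
      rw [Finset.noncommProd_insert_of_notMem _ _ _ _ he, Module.End.mul_apply, ih]
      rcases Nat.le_one_iff_eq_zero_or_eq_one.mp (hs e) with h0 | h1
      · rw [h0, pow_zero, Module.End.one_apply]
        refine Finset.prod_congr rfl fun e' _ => ?_
        by_cases hee : e' = e
        · subst hee; simp [h0]
        · simp [hee]
      · rw [h1, pow_one]
        change pderiv e _ = _
        rw [derivation_prod_univ _ e]
        · refine Finset.prod_congr rfl fun e' _ => ?_
          by_cases hee : e' = e
          · subst hee; simp [h1, he]
          · simp [hee]
        · intro e' he'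
          split_ifs
          · rw [pderiv_pderiv_comm, h e e' he', map_zero]
          · exact h e e' he'
  rw [monomialD_eq_noncommProd, hS]
  refine Finset.prod_congr rfl fun e _ => ?_
  by_cases h0 : s e = 0 <;> simp [h0]

/-- Both sides factor over e. In one pair of variables, ∂ₓ + ∂ᵧ sends y, xy, 1, x to 1, x + y, 0, 1,
which are the values at x + y of ∂^s z^m for (m, s) = (0,0), (1,0), (0,1), (1,1). -/
theorem eval_iterSumDeriv_monomial [DecidableEq E] (m s : E →₀ ℕ) (hm : ∀ e, m e ≤ 1)
    (hs : ∀ e, s e ≤ 1) (x y : E → ℝ) :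
    eval (Sum.elim x y) (iterSumDeriv Finset.univ.toList (rename Sum.inl (monomial m 1) *
      rename Sum.inr (monomial (Finsupp.equivFunOnFinite.symm fun i => 1 - s i) 1))) =
    eval (x + y) (monomialD s (monomial m 1)) := by
  have hkill : ∀ e e', e' ≠ e → sumDeriv e ((X (Sum.inl e') : MvPolynomial (E ⊕ E) ℝ) ^ m e' *
      X (Sum.inr e') ^ (1 - s e')) = 0 := by
    intro e e' he
    have h1 : pderiv (Sum.inl e) (X (Sum.inl e') : MvPolynomial (E ⊕ E) ℝ) = 0 :=
      pderiv_X_of_ne (by simpa using he)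
    have h2 : pderiv (Sum.inl e) (X (Sum.inr e') : MvPolynomial (E ⊕ E) ℝ) = 0 :=
      pderiv_X_of_ne (by simp)
    have h3 : pderiv (Sum.inr e) (X (Sum.inl e') : MvPolynomial (E ⊕ E) ℝ) = 0 :=
      pderiv_X_of_ne (by simp)
    have h4 : pderiv (Sum.inr e) (X (Sum.inr e') : MvPolynomial (E ⊕ E) ℝ) = 0 :=
      pderiv_X_of_ne (by simpa using he)
    simp [sumDeriv_apply, h1, h2, h3, h4]
  have hkill' : ∀ e e', e' ≠ e → pderiv e ((X e' : MvPolynomial E ℝ) ^ m e') = 0 := by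
    intro e e' he
    simp [pderiv_X_of_ne he]
  rw [monomial_one_eq_prod, monomial_one_eq_prod, map_prod (rename (R := ℝ) Sum.inl),
    map_prod (rename (R := ℝ) Sum.inr), ← Finset.prod_mul_distrib, monomialD_prod s hs _ hkill',
    map_prod (eval (x + y))]
  simp only [map_pow, rename_X, Finsupp.coe_equivFunOnFinite_symm]
  rw [iterSumDeriv_prod _ hkill _ (Finset.nodup_toList _), map_prod]
  refine Finset.prod_congr rfl fun e _ => ?_
  have h2 : pderiv (Sum.inl e) (X (Sum.inr e) : MvPolynomial (E ⊕ E) ℝ) = 0 :=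
    pderiv_X_of_ne (by simp)
  have h3 : pderiv (Sum.inr e) (X (Sum.inl e) : MvPolynomial (E ⊕ E) ℝ) = 0 :=
    pderiv_X_of_ne (by simp)
  rw [if_pos (Finset.mem_toList.mpr (Finset.mem_univ e)), sumDeriv_apply]
  rcases Nat.le_one_iff_eq_zero_or_eq_one.mp (hm e) with h | h <;>
  rcases Nat.le_one_iff_eq_zero_or_eq_one.mp (hs e) with h' | h' <;>
  simp [h, h', h2, h3, add_comm]

/-- The additive convolution of `f` with the flip of `h` is `h(∂) f`. -/
theorem eval_iterSumDeriv_flip {f h : MvPolynomial E ℝ} (hf : Multiaffine f)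
    (hh : Multiaffine h) (x y : E → ℝ) :
    eval (Sum.elim x y) (iterSumDeriv Finset.univ.toList
      (rename Sum.inl f * rename Sum.inr (flip h))) = eval (x + y) (diffOp h f) := by
  classical
  have hscale : ∀ (m : E →₀ ℕ) (c : ℝ), monomial m c = c • monomial m 1 := by
    intro m c; rw [smul_monomial, smul_eq_mul, mul_one]
  have hf' : f = ∑ m ∈ f.support, coeff m f • monomial m 1 := by
    conv_lhs => rw [f.as_sum]
    exact Finset.sum_congr rfl fun m _ => hscale m _
  have hflip : flip h = ∑ s ∈ h.support, coeff s h •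
      monomial (Finsupp.equivFunOnFinite.symm fun i => 1 - s i) 1 :=
    Finset.sum_congr rfl fun s _ => hscale _ _
  rw [hflip, diffOp, map_sum, Finset.mul_sum, map_sum, map_sum, map_sum]
  refine Finset.sum_congr rfl fun s hs => ?_
  rw [map_smul, mul_smul_comm, map_smul, smul_eval, smul_eval]
  congr 1
  rw [hf', map_sum, Finset.sum_mul, map_sum, map_sum, map_sum, map_sum]
  refine Finset.sum_congr rfl fun m hm => ?_
  rw [map_smul, smul_mul_assoc, map_smul, smul_eval, map_smul, smul_eval]
  rw [eval_iterSumDeriv_monomial m s (fun e => (monomial_le_degreeOf e hm).trans (hf e))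
    (fun e => (monomial_le_degreeOf e hs).trans (hh e))]

theorem RealStable.ne_zero_of_im_neg {τ : Type*} {h : MvPolynomial τ ℝ} (hh : RealStable h)
    {z : τ → ℂ} (hz : ∀ i, (z i).im < 0) : aeval z h ≠ 0 := by
  intro h0
  refine hh (fun i => starRingEnd ℂ (z i)) (fun i => by simpa using hz i) ?_
  rw [aeval_conj, h0, map_zero]

theorem aeval_flip {h : MvPolynomial E ℝ} (hh : Multiaffine h) {z : E → ℂ}
    (hz : ∀ e, z e ≠ 0) : aeval z (flip h) = (∏ e, z e) * aeval (fun e => (z e)⁻¹) h := by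
  rw [flip, map_sum, aeval_def (fun e => (z e)⁻¹), eval₂_eq', Finset.mul_sum]
  refine Finset.sum_congr rfl fun m hm => ?_
  rw [aeval_monomial, Finsupp.prod_fintype _ _ fun _ => pow_zero _, mul_left_comm,
    ← Finset.prod_mul_distrib]
  congr 1
  refine Finset.prod_congr rfl fun e _ => ?_
  have h1 := (monomial_le_degreeOf e hm).trans (hh e)
  have := hz e
  rcases Nat.le_one_iff_eq_zero_or_eq_one.mp h1 with h | h <;> simp [h, this]

/-- The flip is z^E h(1/z). Inversion exchanges the two half planes, and real coefficients make h
zero-free in the lower one too. -/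
theorem RealStable.flip {h : MvPolynomial E ℝ} (hh : RealStable h) (hh1 : Multiaffine h) :
    RealStable (flip h) := by
  intro z hz
  have hz0 : ∀ e, z e ≠ 0 := fun e he => by
    have := hz e
    rw [he] at this
    simp at this
  rw [aeval_flip hh1 hz0]
  refine mul_ne_zero (Finset.prod_ne_zero_iff.mpr fun e _ => hz0 e) (hh.ne_zero_of_im_neg ?_)
  intro e
  rw [Complex.inv_im]
  exact div_neg_of_neg_of_pos (by simpa using hz e) (Complex.normSq_pos.mpr (hz0 e))

theorem multiaffine_flip (h : MvPolynomial E ℝ) : Multiaffine (flip h) := by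
  classical
  intro e
  refine (degreeOf_sum_le e _ _).trans (Finset.sup_le fun m _ => ?_)
  refine degreeOf_le_iff.mpr fun n hn => ?_
  rw [Finset.mem_singleton.mp (support_monomial_subset hn)]
  simp

end Flip

/-! ### Substituting block sums, and restriction to the diagonal -/

section Tilde

variable {σ : Type*}

theorem tilde_mul_X (k : ℕ) (q : MvPolynomial σ ℝ) (i : σ) :
    tilde k (q * X i) = tilde k q * ∑ j : Fin k, X (i, j) := by
  simp [tilde]

theorem aeval_tilde (k : ℕ) (q : MvPolynomial σ ℝ) (z : σ × Fin k → ℂ) :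
    aeval z (tilde k q) = aeval (fun i => ∑ j, z (i, j)) q := by
  rw [tilde, comp_aeval_apply]
  simp

theorem RealStable.tilde {k : ℕ} (hk : 0 < k) {q : MvPolynomial σ ℝ} (hq : RealStable q) :
    RealStable (tilde k q) := by
  intro z hz
  rw [aeval_tilde]
  refine hq _ fun i => ?_
  rw [Complex.im_sum]
  exact Finset.sum_pos (fun j _ => hz _) ⟨⟨0, hk⟩, Finset.mem_univ _⟩

theorem Multiaffine.tilde [Fintype σ] (k : ℕ) {q : MvPolynomial σ ℝ} (hq : Multiaffine q) :
    Multiaffine (tilde k q) := by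
  classical
  intro e
  rw [ALS.tilde, aeval_def, eval₂_eq']
  refine (degreeOf_sum_le e _ _).trans (Finset.sup_le fun m hm => ?_)
  rw [algebraMap_eq]
  refine (degreeOf_C_mul_le _ _ _).trans ((degreeOf_prod_le _ _ _).trans ?_)
  refine (Finset.sum_le_sum (g := fun i => if i = e.1 then m i else 0) fun i _ => ?_).trans ?_
  · refine (degreeOf_pow_le _ _ _).trans ?_
    have h1 : degreeOf e (∑ j : Fin k, (X (i, j) : MvPolynomial (σ × Fin k) ℝ)) ≤
        if i = e.1 then 1 else 0 := by
      refine (degreeOf_sum_le e _ _).trans (Finset.sup_le fun j _ => ?_)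
      rw [degreeOf_X]
      split_ifs with h1 h2 h2
      · exact le_rfl
      · exact absurd (congrArg Prod.fst h1).symm h2
      · exact zero_le_one
      · exact le_rfl
    refine (Nat.mul_le_mul_left _ h1).trans ?_
    split_ifs <;> simp
  · rw [Finset.sum_ite_eq' Finset.univ e.1 (fun i => m i), if_pos (Finset.mem_univ _)]
    exact (monomial_le_degreeOf e.1 hm).trans (hq e.1)

/-- The chain rule for the restriction to the diagonal. -/
theorem pderiv_rename_fst (k : ℕ) (i : σ) (F : MvPolynomial (σ × Fin k) ℝ) :
    pderiv i (rename Prod.fst F) = rename Prod.fst (∑ j, pderiv (i, j) F) := by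
  classical
  induction F using MvPolynomial.induction_on with
  | C a => simp
  | add p q hp hq => simp [hp, hq, Finset.sum_add_distrib]
  | mul_X p e h =>
    rw [map_mul, rename_X, pderiv_mul, h]
    simp only [pderiv_mul, Finset.sum_add_distrib, map_add, ← Finset.sum_mul, ← Finset.mul_sum,
      map_mul, rename_X]
    congr 2
    by_cases hi : e.1 = i
    · subst hi
      rw [Finset.sum_eq_single e.2]
      · simp
      · intro j _ hj
        refine pderiv_X_of_ne fun h => hj ?_
        exact (congrArg Prod.snd h).symm
      · simp
    · rw [pderiv_X_of_ne hi, Finset.sum_eq_zero, map_zero]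
      intro j _
      refine pderiv_X_of_ne fun h => hi ?_
      rw [h]

/-- The operator q̃(∂) is q with ∂_i replaced by Σ_j ∂_{i,j}, which is ∂_i after restriction to the
diagonal. -/
theorem rename_fst_diffOp_tilde [Fintype σ] (k : ℕ) (q : MvPolynomial σ ℝ)
    (F : MvPolynomial (σ × Fin k) ℝ) :
    rename Prod.fst (diffOp (tilde k q) F) = diffOp q (rename Prod.fst F) := by
  induction q using MvPolynomial.induction_on generalizing F with
  | C a =>
    have : tilde k (C a : MvPolynomial σ ℝ) = C a := by simp [tilde]
    rw [this, diffOp_C, diffOp_C, map_smul]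
  | add p q hp hq =>
    have : tilde k (p + q) = tilde k p + tilde k q := by simp [tilde]
    rw [this, diffOp_add_left, diffOp_add_left, map_add, hp, hq]
  | mul_X q i h =>
    rw [tilde_mul_X, Finset.mul_sum, diffOp_sum_left]
    simp only [diffOp_mul_X]
    rw [← diffOp_sum_right, h, pderiv_rename_fst]

end Tilde

/-! ### Diagonal and degrees of the polarization -/

section PolarizationAlgebra

variable {σ : Type*} [Fintype σ]

theorem rename_fst_polarization {k : ℕ} {p : MvPolynomial σ ℝ} (hpk : ∀ i, p.degreeOf i ≤ k) :
    rename Prod.fst (polarization k p) = p := by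
  conv_rhs => rw [p.as_sum]
  rw [polarization, map_sum]
  refine Finset.sum_congr rfl fun m hm => ?_
  rw [map_mul, map_prod, rename_C, monomial_eq, Finsupp.prod_fintype _ _ fun _ => pow_zero _]
  congr 1
  refine Finset.prod_congr rfl fun i _ => ?_
  have hmi : m i ≤ k := (monomial_le_degreeOf i hm).trans (hpk i)
  have hch : (k.choose (m i) : ℝ) ≠ 0 := by exact_mod_cast (Nat.choose_pos hmi).ne'
  rw [map_mul, rename_C, rename_rename, esymm, map_sum,
    Finset.sum_congr rfl (g := fun _ => (X i : MvPolynomial σ ℝ) ^ m i)]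
  · rw [Finset.sum_const, Finset.card_powersetCard, Finset.card_univ, Fintype.card_fin,
      nsmul_eq_mul, ← mul_assoc, ← map_natCast (C : ℝ →+* MvPolynomial σ ℝ), ← C_mul,
      inv_mul_cancel₀ hch, C_1, one_mul]
  · intro t ht
    rw [map_prod]
    simp [(Finset.mem_powersetCard.mp ht).2]

theorem degreeOf_esymm_le {τ : Type*} [Fintype τ] (d : ℕ) (j : τ) :
    (esymm τ ℝ d).degreeOf j ≤ 1 := by
  classical
  rw [esymm]
  refine (degreeOf_sum_le j _ _).trans (Finset.sup_le fun t _ => ?_)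
  refine (degreeOf_prod_le _ _ _).trans ?_
  simp only [degreeOf_X]
  rw [Finset.sum_ite_eq]
  split_ifs <;> simp

theorem degreeOf_rename_pair_eq_zero {τ : Type*} (k : ℕ) (i : τ) (F : MvPolynomial (Fin k) ℝ)
    (e : τ × Fin k) (hne : i ≠ e.1) :
    (rename (fun j => (i, j)) F).degreeOf e = 0 := by
  classical
  refine Nat.le_zero.mp (degreeOf_le_iff.mpr fun m hm => Nat.le_zero.mpr ?_)
  by_contra h0
  have := vars_rename _ _ ((mem_vars_iff_mem_support _).mpr
    ⟨m, hm, Finsupp.mem_support_iff.mpr h0⟩)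
  obtain ⟨j, _, hj⟩ := Finset.mem_image.mp this
  exact hne (congrArg Prod.fst hj)

theorem multiaffine_polarization (k : ℕ) (p : MvPolynomial σ ℝ) :
    Multiaffine (polarization k p) := by
  classical
  intro e
  refine (degreeOf_sum_le e _ _).trans (Finset.sup_le fun m hm => ?_)
  refine (degreeOf_C_mul_le _ _ _).trans ((degreeOf_prod_le _ _ _).trans ?_)
  refine (Finset.sum_le_sum (g := fun i => if i = e.1 then 1 else 0) fun i _ => ?_).trans ?_
  · refine (degreeOf_C_mul_le _ _ _).trans ?_
    split_ifs with h
    · obtain ⟨i', j⟩ := e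
      dsimp only at h
      subst h
      rw [degreeOf_rename_of_injective (f := fun j : Fin k => (i, j))
        (fun a b h => by simpa using h)]
      exact degreeOf_esymm_le _ _
    · exact (degreeOf_rename_pair_eq_zero k i _ e h).le
  · rw [Finset.sum_ite_eq' Finset.univ e.1 (fun _ => 1), if_pos (Finset.mem_univ _)]

end PolarizationAlgebra

/-! ### Symmetry within the blocks -/

section Symmetry

variable {σ : Type*} [Fintype σ]

theorem rename_polarization_perm (k : ℕ) (p : MvPolynomial σ ℝ) (π : Equiv.Perm (Fin k)) :
    rename (Prod.map id π) (polarization k p) = polarization k p := by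
  rw [polarization, map_sum]
  refine Finset.sum_congr rfl fun m _ => ?_
  rw [map_mul, rename_C, map_prod]
  congr 1
  refine Finset.prod_congr rfl fun i _ => ?_
  rw [map_mul, rename_C, rename_rename]
  congr 1
  have : (Prod.map id π ∘ fun j : Fin k => (i, j)) = (fun j => (i, j)) ∘ π := rfl
  rw [this, ← rename_rename, rename_esymm]

theorem rename_tilde_perm {τ : Type*} (k : ℕ) (q : MvPolynomial τ ℝ) (π : Equiv.Perm (Fin k)) :
    rename (Prod.map id π) (tilde k q) = tilde k q := by
  rw [tilde, comp_aeval_apply]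
  congr 2
  funext i
  rw [map_sum]
  simp only [rename_X, Prod.map_apply, id]
  exact Equiv.sum_comp π fun j => (X (i, j) : MvPolynomial (τ × Fin k) ℝ)

theorem rename_flip_of_rename_eq {h : MvPolynomial σ ℝ} (π : Equiv.Perm σ)
    (hh : rename π h = h) : rename π (flip h) = flip h := by
  classical
  have hco : ∀ m, coeff (Finsupp.mapDomain π m) h = coeff m h := by
    intro m
    conv_lhs => rw [← hh]
    exact coeff_rename_mapDomain _ π.injective _ _
  rw [flip, map_sum]
  refine Finset.sum_bij (fun m _ => Finsupp.mapDomain π m) ?_ ?_ ?_ ?_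
  · intro m hm
    rw [mem_support_iff] at hm ⊢
    rwa [hco]
  · intro m _ m' _ hmm
    exact Finsupp.mapDomain_injective π.injective hmm
  · intro m hm
    have h1 : Finsupp.mapDomain π (Finsupp.mapDomain π.symm m) = m := by
      rw [← Finsupp.mapDomain_comp]; simp
    refine ⟨Finsupp.mapDomain π.symm m, ?_, h1⟩
    rw [mem_support_iff] at hm ⊢
    rwa [← hco, h1]
  · intro m _
    rw [hco, rename_monomial]
    congr 2
    ext i
    obtain ⟨i, rfl⟩ := π.surjective i
    rw [Finsupp.mapDomain_apply π.injective]
    simp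

/-- A transposition within the blocks fixes both F and the repeated point. Hence φ_i, defined with
the first copy, serves for every copy. -/
theorem potential_repeated_eq {τ : Type*} (k : ℕ) {F : MvPolynomial (τ × Fin k) ℝ}
    (hF : ∀ π : Equiv.Perm (Fin k), rename (Prod.map id π) F = F) (a : τ → ℝ) (i : τ)
    (j j' : Fin k) : potential (i, j) F (repeated k a) = potential (i, j') F (repeated k a) := by
  have hF' := hF (Equiv.swap j' j)
  have hinj : Function.Injective (Prod.map id (Equiv.swap j' j) : τ × Fin k → τ × Fin k) :=
    Function.injective_id.prodMap (Equiv.injective _)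
  have h1 := pderiv_rename hinj (i, j') F
  rw [hF', Prod.map_apply, Equiv.swap_apply_left, id] at h1
  rw [potential, potential, h1, eval_rename]
  rfl

end Symmetry

end ALS

/-! ### The main theorem -/

theorem mainTheorem2 (n k : ℕ) (hk : 0 < k) (p q : MvPolynomial (Fin n) ℝ)
    (hp : ALS.RealStable p) (hq : ALS.RealStable q)
    (hpk : ∀ i, p.degreeOf i ≤ k) (hq1 : ALS.Multiaffine q)
    (hr : ALS.diffOp q p ≠ 0)
    (a b : Fin n → ℝ) (ha : ALS.AboveRoots a p)
    (hb : ALS.AboveRoots (ALS.repeated k b) (ALS.flip (ALS.tilde k q)))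
    (φ : Fin n → ℝ)
    (hφ : ∀ i, φ i =
      ALS.potential (i, ⟨0, hk⟩) (ALS.polarization k p) (ALS.repeated k a) +
      ALS.potential (i, ⟨0, hk⟩) (ALS.flip (ALS.tilde k q)) (ALS.repeated k b)) :
    (∀ i, 0 < φ i) ∧
      ALS.AboveRoots (fun i => a i + b i - 1 / φ i) (ALS.diffOp q p) := by
  classical
  open ALS MvPolynomial in
  have hf := hp.polarization hpk
  have hf1 := multiaffine_polarization k p
  have hfa := AboveRoots.polarization hp hpk ha
  have hh1 := hq1.tilde k
  have hg := (hq.tilde hk).flip hh1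
  have hg1 := multiaffine_flip (tilde k q)
  have hdiag : ∀ u v : Fin n → ℝ,
      eval (Sum.elim (repeated k u) (repeated k v)) (iterSumDeriv Finset.univ.toList
        (rename Sum.inl (polarization k p) * rename Sum.inr (flip (tilde k q)))) =
      eval (u + v) (diffOp q p) := by
    intro u v
    rw [eval_iterSumDeriv_flip hf1 hh1]
    conv_rhs => rw [← rename_fst_polarization hpk, ← rename_fst_diffOp_tilde, eval_rename]
    rfl
  have hsym : ∀ e : Fin n × Fin k, φ e.1 =
      potential (Sum.inl e) (rename Sum.inl (polarization k p) *
        rename Sum.inr (flip (tilde k q))) (Sum.elim (repeated k a) (repeated k b)) +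
      potential (Sum.inr e) (rename Sum.inl (polarization k p) *
        rename Sum.inr (flip (tilde k q))) (Sum.elim (repeated k a) (repeated k b)) := by
    rintro ⟨i, j⟩
    rw [potential_inl_separatedProduct hb.eval_ne_zero,
      potential_inr_separatedProduct hfa.eval_ne_zero, hφ,
      potential_repeated_eq k (rename_polarization_perm k p) a i ⟨0, hk⟩ j,
      potential_repeated_eq k (F := flip (tilde k q)) (fun π =>
        rename_flip_of_rename_eq ((Equiv.refl _).prodCongr π) (rename_tilde_perm k q π))
        b i ⟨0, hk⟩ j]
  have hne : iterSumDeriv Finset.univ.toList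
      (rename Sum.inl (polarization k p) * rename Sum.inr (flip (tilde k q))) ≠ 0 := by
    intro h0
    refine hr (MvPolynomial.funext fun u => ?_)
    have := hdiag u 0
    rw [h0, add_zero, map_zero] at this
    rw [← this, map_zero]
  obtain ⟨-, -, hpos, habove, -⟩ := iterSumDeriv_barrier (hf.separatedProduct hg)
    (hf1.separatedProduct hg1) (hfa.separatedProduct hb) hsym _ (Finset.nodup_toList _) hne
  refine ⟨fun i => hpos (i, ⟨0, hk⟩) (Finset.mem_toList.mpr (Finset.mem_univ _)), ?_⟩
  intro t ht
  -- Only x + y matters on the diagonal, so it is enough to move the x half by t.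
  have h1 := habove (Sum.elim (repeated k t) 0) (by
    rintro (e | e)
    · exact ht e.1
    · exact le_rfl)
  have h2 : lowered (Sum.elim (repeated k a) (repeated k b)) (fun e => 1 / φ e.1)
      Finset.univ.toList + Sum.elim (repeated k t) 0 =
      Sum.elim (repeated k (fun i => a i - 1 / φ i + t i)) (repeated k b) := by
    funext e
    rcases e with e | e
    · simp [lowered, repeated]
    · simp [lowered]
  rw [h2, hdiag] at h1
  convert h1 using 2
  congr 1
  funext i
  simp only [Pi.add_apply]
  ring
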